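/- Let $X=(X_t)_{t\in\mathbb R}$ be a two-sided real-valued L\'evy process on a probability space $(\Omega,\mathcal F,\mathbb P)$ (all paths are c\`adl\`ag, the increments are stationary and independent, $X_0=0$ a.s.) with $\mathbb E[X_1^+]<\infty$, so that $\mathbb E[X_1]\in[-\infty,\infty)$. For $\alpha\in\mathbb R$ put $$\mathcal H_\alpha=\Bigl\{t\in\mathbb R:\ X_t\wedge X_{t-}=\inf_{s\le t}\bigl(X_s+\alpha(t-s)\bigr)\Bigr\}.$$ For closed $F\subseteq\mathbb R$ and $t\in\mathbb R$ let $d_t(F)=\inf\{s>t:s\in F\}$ (with $\inf\emptyset=+\infty$), $r_t(F)=d_t(F)-t$, and let $\tau_t(F)$ be the closure of $(F-t)\cap(0,\infty)$. The space of closed subsets of $\mathbb R$ carries the $\sigma$-field generated by the maps $r_t$, $t\in\mathbb R$; the closed subsets of $[0,\infty)$, and the increasing families of closed subsets of $\mathbb R$ or of $[0,\infty)$, carry the induced (trace, product) $\sigma$-fields. Let $\mathbb E[X_1]<\alpha_1<\dots<\alpha_n$. Then $\mathcal H_{\alpha_1}\prec\mathcal H_{\alpha_2}\prec\dots\prec\mathcal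 H_{\alpha_n}$, that is: the sets $\mathcal H_{\alpha_1}\subseteq\dots\subseteq\mathcal H_{\alpha_n}$ are closed, $(\mathcal H_{\alpha_1},\dots,\mathcal H_{\alpha_n})$ is a random element of the space of increasing $n$-tuples of closed subsets of $\mathbb R$, and its distribution $\mathcal P$ is a regenerative embedding law. The latter means that there is a probability measure $\mathcal P^{\rightarrow}$ on the increasing $n$-tuples of closed subsets of $[0,\infty)$ such that, for every $k\in\{1,\dots,n\}$, every $t\in\mathbb R$ and every bounded measurable real function $f$ of increasing families $(F_j)_{k\le j\le n}$ of closed subsets of $[0,\infty)$, $$\mathcal P\bigl[f\bigl((\tau_{d}(M^{(j)}))_{k\le j\le n}\bigr)\,\big|\,\mathcal G^{(k)}_t\bigr]=\mathcal P^{\rightarrow}\bigl[f\bigl((M^{(j)})_{k\le j\le n}\bigr)\bigr]\quad\text{a.s. on }\{d<\infty\},\qquad d:=d_t(M^{(k)}),$$ where $M^{(1)}\subseteq\dots\subseteq M^{(n)}$ are the canonical projections and $\mathcal G^{(k)}_t$ is the $\sigma$-field generated by $d_t(M^{(k)})$ and the sets $M^{(j)}\cap(-\infty,d_t(M^{(k)})]$,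 $1\le j\le n$. (For $n=2$, the case $k=1$ is the defining property of a regenerative embedding $M^{(1)}\prec M^{(2)}$.) -/

import Mathlib

open MeasureTheory ProbabilityTheory Set Filter Topology TopologicalSpace

noncomputable section

namespace EmbeddedRegenerative

/-! ### Two-sided Lévy processes -/

/-- A function on the real line is càdlàg: right-continuous, with finite left limits. -/
def IsCadlag (f : ℝ → ℝ) : Prop :=
  ∀ t : ℝ, Tendsto f (𝓝[>] t) (𝓝 (f t)) ∧ ∃ l : ℝ, Tendsto f (𝓝[<] t) (𝓝 l)

/-- `X` is a two-sided real-valued Lévy process: it starts from `0`, has càdlàg paths, and has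
stationary and independent increments. -/
structure IsTwoSidedLevy {Ω : Type*} [MeasurableSpace Ω] (X : ℝ → Ω → ℝ) (μ : Measure Ω) :
    Prop where
  measurable : ∀ t, Measurable (X t)
  cadlag : ∀ ω, IsCadlag (fun t => X t ω)
  zero : ∀ᵐ ω ∂μ, X 0 ω = 0
  indep : HasIndepIncrements X μ
  stationary : ∀ (t h : ℝ), 0 ≤ h →
    IdentDistrib (fun ω => X (t + h) ω - X t ω) (fun ω => X h ω - X 0 ω) μ μ

/-- The expectation `E[Y] = E[Y⁺] - E[Y⁻]` as an extended real number (meaningful as soon as one of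
the two terms is finite; `-∞` is allowed as a value). -/
def extMean {Ω : Type*} [MeasurableSpace Ω] (μ : Measure Ω) (Y : Ω → ℝ) : EReal :=
  ((∫⁻ ω, ENNReal.ofReal (Y ω) ∂μ : ENNReal) : EReal)
    - ((∫⁻ ω, ENNReal.ofReal (-Y ω) ∂μ : ENNReal) : EReal)

/-- The contact set `{t : x(t) ∧ x(t-) = inf {x(s) + α (t - s) : s ≤ t}}` of a path `x`.
(When the infimum is `-∞` there is no contact at `t`.) -/
def contactSet (α : ℝ) (x : ℝ → ℝ) : Set ℝ :=
  {t | IsGLB {y | ∃ s ≤ t, y = x s + α * (t - s)} (min (x t) (Function.leftLim x t))}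

/-! ### Closed subsets of the line and of the half-line -/

/-- `d_t(F) = inf {s > t : s ∈ F}`, with `inf ∅ = +∞`. -/
def nextPoint (t : ℝ) (F : Set ℝ) : EReal :=
  sInf ((fun s : ℝ => (s : EReal)) '' (F ∩ Ioi t))

/-- `r_t(F) = d_t(F) - t`. -/
def gap (t : ℝ) (F : Set ℝ) : EReal :=
  nextPoint t F - (t : EReal)

/-- The `σ`-field on the space of closed subsets of `ℝ` generated by all the maps `r_t`. -/
instance instMeasurableSpaceCloseds : MeasurableSpace (Closeds ℝ) :=
  ⨆ t : ℝ, MeasurableSpace.comap (fun F : Closeds ℝ => gap t (F : Set ℝ)) inferInstance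

/-- The closed subsets of `[0, ∞)`, with the trace `σ`-field (it is generated by all the `r_t`,
`t ∈ ℝ`, so that the event `0 ∈ F` is measurable). -/
abbrev HalfCloseds : Type := {F : Closeds ℝ // (F : Set ℝ) ⊆ Ici 0}

/-- Increasing families of closed subsets of `ℝ`, with the trace of the product `σ`-field. -/
abbrev Nested (ι : Type) [Preorder ι] : Type := {F : ι → Closeds ℝ // Monotone F}

/-- Increasing families of closed subsets of `[0, ∞)`, with the trace of the product `σ`-field. -/
abbrev NestedHalf (ι : Type) [Preorder ι] : Type := {F : ι → HalfCloseds // Monotone F}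

/-- `τ_t(F)`, the closure of `(F - t) ∩ (0, ∞)`. -/
def shift (t : ℝ) (F : Set ℝ) : HalfCloseds :=
  ⟨⟨closure ((fun s => s - t) '' (F ∩ Ioi t)), isClosed_closure⟩, by
    refine closure_minimal ?_ isClosed_Ici
    rintro _ ⟨s, ⟨-, hs⟩, rfl⟩
    exact sub_nonneg.2 (le_of_lt (mem_Ioi.1 hs))⟩

/-- `F ∩ (-∞, c]`. -/
def upTo (c : EReal) (F : Closeds ℝ) : Closeds ℝ :=
  ⟨(F : Set ℝ) ∩ {x : ℝ | (x : EReal) ≤ c},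
    F.isClosed.inter (isClosed_Iic.preimage continuous_coe_real_ereal)⟩

/-! ### Regenerative embeddings -/

/-- `d_t^{(k)}(F) = d_t(F_k)`. -/
def nextPointOf {n : ℕ} (k : Fin n) (t : ℝ) (F : Nested (Fin n)) : EReal :=
  nextPoint t (F.1 k : Set ℝ)

/-- The `σ`-field `G_t^{(k)}` generated by `d_t^{(k)}` and all the truncated sets
`F_j ∩ (-∞, d_t^{(k)}]`. -/
@[reducible]
def pastOf {n : ℕ} (k : Fin n) (t : ℝ) : MeasurableSpace (Nested (Fin n)) :=
  MeasurableSpace.comap (nextPointOf k t) inferInstance ⊔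
    ⨆ j : Fin n, MeasurableSpace.comap
      (fun F : Nested (Fin n) => upTo (nextPointOf k t F) (F.1 j)) inferInstance

/-- The future `(τ_t(F_j))_{j ≥ k}` after the time `t` of the sets with index at least `k`. -/
def futureOf {n : ℕ} (k : Fin n) (t : ℝ) (F : Nested (Fin n)) : NestedHalf (Ici k) :=
  ⟨fun j => shift t (F.1 j : Set ℝ), fun i j hij => by
    refine closure_mono (image_mono (inter_subset_inter_left _ ?_))
    exact F.2 (show (i : Fin n) ≤ j from hij)⟩

/-- The subfamily `(F_j)_{j ≥ k}` of a family of closed subsets of `[0, ∞)`. -/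
def tailOf {n : ℕ} (k : Fin n) (F : NestedHalf (Fin n)) : NestedHalf (Ici k) :=
  ⟨fun j => F.1 j, fun i j hij => F.2 (show (i : Fin n) ≤ j from hij)⟩

/-- `P` is a regenerative embedding law with regeneration law `Q`: for every index `k`, every time
`t` and every bounded measurable `f`, on the event `d_t^{(k)} < ∞`,
`P[f((τ_{d_t^{(k)}} F_j)_{j ≥ k}) | G_t^{(k)}] = Q[f((F_j)_{j ≥ k})]`.
(The real number `toReal` of `d_t^{(k)}` is arbitrary off that event, which does not matter.) -/
def IsRegenerativeEmbeddingLaw {n : ℕ} (P : Measure (Nested (Fin n)))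
    (Q : Measure (NestedHalf (Fin n))) : Prop :=
  ∀ (k : Fin n) (t : ℝ) (f : NestedHalf (Ici k) → ℝ), Measurable f → (∃ C, ∀ x, |f x| ≤ C) →
    P[fun F => f (futureOf k (nextPointOf k t F).toReal F) | pastOf k t]
      =ᵐ[P.restrict {F | nextPointOf k t F < ⊤}] fun _ => ∫ G, f (tailOf k G) ∂Q

/-- `S 0 ≺ S 1 ≺ ... ≺ S (n - 1)`: the `S i` are closed random sets, increasing in `i`, they form a
random element of the space of increasing families of closed sets, and the distribution of this
random element is a regenerative embedding law for some probability measure as regeneration law. -/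
def RegenerativelyEmbedded {Ω : Type*} [MeasurableSpace Ω] (μ : Measure Ω) {n : ℕ}
    (S : Fin n → Ω → Set ℝ) : Prop :=
  ∃ M : Ω → Nested (Fin n), Measurable M ∧ (∀ ω i, ((M ω).1 i : Set ℝ) = S i ω) ∧
    ∃ Q : Measure (NestedHalf (Fin n)), IsProbabilityMeasure Q ∧
      IsRegenerativeEmbeddingLaw (μ.map M) Q

end EmbeddedRegenerative

end

noncomputable section

namespace EmbeddedRegenerative

/-! ### Càdlàg paths and their contact sets -/

/-! After subtracting the line of slope `α`, a contact time is a time at which the path or its left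
limit is at its running infimum. Let `d` be the first contact time after `t` for the slope `α k`,
and suppose that `X` itself, not merely its left limit, is at the infimum at `d`. For `α j ≥ α k`
the path tilted by `α j` then lies, before `d`, above its value at `d`, so comparing a later time
with the past of `d` reduces to comparing it with `d`. The part of the `j`-th contact set after `d`
is thus a fixed functional of the increments after `d` (`shift_contactSet`). By the strong Markov
property (`map_incrPath`) these are independent of the past of `d` and distributed like the
increments after `0`; the image of their law under the functional is the regeneration law. The
conditioning `σ`-field lies in the past of `d` because increments before `q` decide where the
contacts before `q` are (`IsCadlag.exists_mem_lowPoints_iff`, `measurableSet_pastOf_inter`).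

It remains to exclude an upward jump from the infimum at `d` (`measure_jumpEvent`). If contacts
accumulate at `t` from the right, then `d = t` and right continuity suffices. Otherwise `d` ends a
gap, and before such a jump the path would come arbitrarily close to its old infimum at times
increasing strictly to `d`. By the strong Markov property at these times, a rise larger than `ε`
within a short time after them has small probability. -/

lemma IsCadlag.tendsto_leftLim {y : ℝ → ℝ} (hy : IsCadlag y) (t : ℝ) :
    Tendsto y (𝓝[<] t) (𝓝 (Function.leftLim y t)) :=
  tendsto_leftLim_of_tendsto (hy t).2

lemma IsCadlag.sub_linear {x : ℝ → ℝ} (hx : IsCadlag x) (α : ℝ) :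
    IsCadlag fun s => x s - α * s := by
  have hc (t : ℝ) (s : Set ℝ) : Tendsto (fun s => α * s) (𝓝[s] t) (𝓝 (α * t)) :=
    (continuous_const.mul continuous_id).continuousWithinAt
  intro t
  refine ⟨(hx t).1.sub (hc t _), ?_⟩
  obtain ⟨l, hl⟩ := (hx t).2
  exact ⟨_, hl.sub (hc t _)⟩

lemma IsCadlag.leftLim_sub_linear {x : ℝ → ℝ} (hx : IsCadlag x) (α t : ℝ) :
    Function.leftLim (fun s => x s - α * s) t = Function.leftLim x t - α * t := by
  have hc : Tendsto (fun s => α * s) (𝓝[<] t) (𝓝 (α * t)) :=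
    (continuous_const.mul continuous_id).continuousWithinAt
  exact leftLim_eq_of_tendsto ((hx.tendsto_leftLim t).sub hc)

/-- The times at which a path (or its left limit) is at its running infimum. -/
def lowPoints (y : ℝ → ℝ) : Set ℝ :=
  {t | ∀ s ≤ t, min (y t) (Function.leftLim y t) ≤ y s}

lemma contactSet_eq_lowPoints {x : ℝ → ℝ} (hx : IsCadlag x) (α : ℝ) :
    contactSet α x = lowPoints fun s => x s - α * s := by
  ext t
  simp only [contactSet, lowPoints, mem_ofPred_eq, hx.leftLim_sub_linear, min_sub_sub_right]
  constructor
  · intro h s hs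
    have := h.1 ⟨s, hs, rfl⟩
    linarith
  · intro h
    refine ⟨?_, ?_⟩
    · rintro _ ⟨s, hs, rfl⟩
      linarith [h s hs]
    · intro b hb
      refine le_min ?_ ?_
      · simpa using hb ⟨t, le_rfl, rfl⟩
      · have hc : Tendsto (fun s => x s + α * (t - s)) (𝓝[<] t)
            (𝓝 (Function.leftLim x t + α * (t - t))) :=
          (hx.tendsto_leftLim t).add
            (continuous_const.mul (continuous_const.sub continuous_id)).continuousWithinAt
        simp only [sub_self, mul_zero, add_zero] at hc
        refine ge_of_tendsto hc ?_
        filter_upwards [self_mem_nhdsWithin] with s hs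
        exact hb ⟨s, le_of_lt hs, rfl⟩

/-- If an earlier value is strictly below both `y t` and the left limit, the one-sided limits keep
the path above a level exceeding that value on a whole neighbourhood of `t`. -/
lemma isClosed_lowPoints {y : ℝ → ℝ} (hy : IsCadlag y) : IsClosed (lowPoints y) := by
  rw [← isOpen_compl_iff, isOpen_iff_mem_nhds]
  intro t ht
  simp only [mem_compl_iff, lowPoints, mem_ofPred_eq, not_forall, not_le] at ht
  obtain ⟨s, hst, hs⟩ := ht
  obtain ⟨h1, h2⟩ := lt_min_iff.1 hs
  have hst : s < t := lt_of_le_of_ne hst fun h => by simp [h] at h1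
  obtain ⟨c, hc, hc'⟩ := exists_between hs
  obtain ⟨h1, h2⟩ := lt_min_iff.1 hc'
  have hl := (hy.tendsto_leftLim t).eventually (lt_mem_nhds h2)
  have hr := (hy t).1.eventually (lt_mem_nhds h1)
  rw [eventually_nhdsWithin_iff, Metric.eventually_nhds_iff] at hl hr
  obtain ⟨δ, hδ, hl⟩ := hl
  obtain ⟨δ', hδ', hr⟩ := hr
  rw [← nhdsNE_sup_pure, mem_sup]
  have key : ∀ u, s < u → dist u t < δ → dist u t < δ' → u ∉ lowPoints y := by
    intro u hsu hu hu' hlow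
    have hall : ∀ v, s < v → dist v t < δ → dist v t < δ' → c < y v := by
      intro v hsv hv hv'
      rcases lt_trichotomy v t with h | rfl | h
      · exact hl hv h
      · exact h1
      · exact hr hv' h
    have h3 : c ≤ Function.leftLim y u := by
      refine ge_of_tendsto (hy.tendsto_leftLim u) ?_
      filter_upwards [nhdsWithin_le_nhds (lt_mem_nhds hsu),
        nhdsWithin_le_nhds (Metric.isOpen_ball.mem_nhds hu),
        nhdsWithin_le_nhds (Metric.isOpen_ball.mem_nhds hu')] with v hv hv' hv''
      exact (hall v hv hv' hv'').le
    have := hlow s hsu.le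
    exact absurd this (not_le.2 (lt_of_lt_of_le hc (le_min (hall u hsu hu hu').le h3)))
  have hev : ∀ᶠ u in 𝓝 t, u ∉ lowPoints y := by
    filter_upwards [lt_mem_nhds hst, Metric.ball_mem_nhds t hδ, Metric.ball_mem_nhds t hδ']
      with u h1 h2 h3 using key u h1 h2 h3
  exact ⟨nhdsWithin_le_nhds hev, by simpa using hev.self_of_nhds⟩

/-! ### Detecting low points at rational times. -/

/-- Compactness replaces the attained minimum, which a càdlàg path need not have. The left limit at
`a` plays no role, since it is not approached from inside the interval. -/
lemma IsCadlag.exists_pos_add_le {y : ℝ → ℝ} (hy : IsCadlag y) {a b c : ℝ}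
    (h1 : ∀ u ∈ Icc a b, c < y u) (h2 : ∀ u ∈ Ioc a b, c < Function.leftLim y u) :
    ∃ ε > 0, ∀ r ∈ Icc a b, c + ε ≤ y r := by
  refine isCompact_Icc.induction_on (p := fun s => ∃ ε > 0, ∀ r ∈ s, c + ε ≤ y r)
    ⟨1, one_pos, by simp⟩ ?_ ?_ ?_
  · rintro s t hst ⟨ε, hε, h⟩
    exact ⟨ε, hε, fun r hr => h r (hst hr)⟩
  · rintro s t ⟨ε, hε, h⟩ ⟨ε', hε', h'⟩
    refine ⟨min ε ε', lt_min hε hε', fun r hr => ?_⟩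
    rcases hr with hr | hr
    · linarith [h r hr, min_le_left ε ε']
    · linarith [h' r hr, min_le_right ε ε']
  · intro u hu
    obtain ⟨c1, hc1, hc1'⟩ := exists_between (h1 u hu)
    have hr := (hy u).1.eventually (lt_mem_nhds hc1')
    obtain ⟨c2, hc2, hl⟩ : ∃ c2 > c, ∀ᶠ r in 𝓝[<] u, a ≤ r → c2 < y r := by
      rcases hu.1.eq_or_lt with h | h
      · refine ⟨c + 1, by linarith, ?_⟩
        filter_upwards [self_mem_nhdsWithin] with r hr hr'
        exact absurd hr' (not_le.2 (h ▸ hr))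
      · obtain ⟨c2, hc2, hc2'⟩ := exists_between (h2 u ⟨h, hu.2⟩)
        refine ⟨c2, hc2, ?_⟩
        filter_upwards [(hy.tendsto_leftLim u).eventually (lt_mem_nhds hc2')] with r hr _ using hr
    rw [eventually_nhdsWithin_iff] at hl hr
    refine ⟨{r | (r < u → a ≤ r → c2 < y r) ∧ (u < r → c1 < y r) ∧ a ≤ r}, ?_,
      min (c1 - c) (c2 - c), lt_min (by linarith) (by linarith), ?_⟩
    · filter_upwards [nhdsWithin_le_nhds hl, nhdsWithin_le_nhds hr, self_mem_nhdsWithin]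
        with r h1 h2 h3 using ⟨h1, h2, h3.1⟩
    · rintro r ⟨h3, h4, h5⟩
      have := min_le_left (c1 - c) (c2 - c)
      have := min_le_right (c1 - c) (c2 - c)
      rcases lt_trichotomy r u with h | rfl | h
      · linarith [h3 h h5]
      · linarith
      · linarith [h4 h]

lemma IsCadlag.bddBelow_image_Icc {y : ℝ → ℝ} (hy : IsCadlag y) (a b : ℝ) :
    BddBelow (y '' Icc a b) := by
  refine isCompact_Icc.induction_on (p := fun s => BddBelow (y '' s)) (by simp) ?_ ?_ ?_
  · exact fun s t hst h => h.mono (image_mono hst)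
  · intro s t h h'
    rw [image_union]
    exact h.union h'
  · intro u _
    have hr := (hy u).1.eventually (lt_mem_nhds (sub_one_lt (y u)))
    have hl := (hy.tendsto_leftLim u).eventually (lt_mem_nhds (sub_one_lt _))
    rw [eventually_nhdsWithin_iff] at hl hr
    refine ⟨_, nhdsWithin_le_nhds (hl.and hr), min (Function.leftLim y u - 1) (y u - 1), ?_⟩
    rintro _ ⟨r, ⟨h1, h2⟩, rfl⟩
    rcases lt_trichotomy r u with h | rfl | h
    · exact (min_le_left _ _).trans (h1 h).le
    · exact (min_le_right _ _).trans (by linarith)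
    · exact (min_le_right _ _).trans (h2 h).le

/-- If there is no low point in `[a, b]` then the path stays on `[a, b]` above a level that it has
visited before. -/
lemma IsCadlag.exists_add_le_of_disjoint {y : ℝ → ℝ} (hy : IsCadlag y) {a b : ℝ}
    (h : Disjoint (lowPoints y) (Icc a b)) :
    ∃ s ≤ a, ∃ ε > 0, ∀ r ∈ Icc a b, y s + ε ≤ y r := by
  rcases lt_or_ge b a with hab | hab
  · exact ⟨a, le_rfl, 1, one_pos, by simp [Icc_eq_empty (not_le.2 hab)]⟩
  by_contra! hcon
  have hbdd := hy.bddBelow_image_Icc a b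
  have hne : (y '' Icc a b).Nonempty := (nonempty_Icc.2 hab).image y
  set c := sInf (y '' Icc a b)
  have hc (r) (hr : r ∈ Icc a b) : c ≤ y r := csInf_le hbdd (mem_image_of_mem y hr)
  -- By `hcon`, the infimum over `[a, b]` also bounds the path before `a`; so a point of `[a, b]`
  -- where the value or left limit is at most `c` would be low.
  have hc' (s) (hs : s ≤ b) : c ≤ y s := by
    rcases le_total s a with hsa | hsa
    · refine le_of_forall_pos_le_add fun ε hε => ?_
      obtain ⟨r, hr, hr'⟩ := hcon s hsa ε hε
      exact (hc r hr).trans hr'.le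
    · exact hc s ⟨hsa, hs⟩
  have hlow (u) (hu : u ∈ Icc a b) : c < min (y u) (Function.leftLim y u) := by
    by_contra! hle
    exact disjoint_left.1 h (fun s hs => hle.trans (hc' s (hs.trans hu.2))) hu
  obtain ⟨ε, hε, hr⟩ := hy.exists_pos_add_le (c := c)
    (fun u hu => (lt_min_iff.1 (hlow u hu)).1)
    (fun u hu => (lt_min_iff.1 (hlow u ⟨hu.1.le, hu.2⟩)).2)
  have : c + ε ≤ c := le_csInf hne (by rintro _ ⟨r, hr', rfl⟩; exact hr r hr')
  linarith

lemma IsCadlag.exists_lt_add_of_mem_lowPoints {y : ℝ → ℝ} (hy : IsCadlag y) {a u : ℝ}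
    (hu : u ∈ lowPoints y) (hau : a < u) {s : ℝ} (hs : s ≤ u) {ε : ℝ} (hε : 0 < ε) :
    ∃ r ∈ Icc a u, y r < y s + ε := by
  rcases min_le_iff.1 (hu s hs) with h | h
  · exact ⟨u, ⟨hau.le, le_rfl⟩, by linarith⟩
  · have h1 := (hy.tendsto_leftLim u).eventually
      (gt_mem_nhds (show Function.leftLim y u < y s + ε by linarith))
    obtain ⟨r, hr, hr1, hr2⟩ := (h1.and (Ioo_mem_nhdsLT hau)).exists
    exact ⟨r, ⟨hr1.le, hr2.le⟩, hr⟩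

lemma IsCadlag.exists_rat_lt {y : ℝ → ℝ} (hy : IsCadlag y) {r b c : ℝ} (hrb : r < b)
    (h : y r < c) : ∃ p : ℚ, r < p ∧ (p : ℝ) < b ∧ y p < c := by
  have h1 := (hy r).1.eventually (gt_mem_nhds h)
  obtain ⟨δ, hδ, h2⟩ := mem_nhdsGT_iff_exists_Ioo_subset.1 h1
  obtain ⟨p, hp, hp'⟩ := exists_rat_btwn (lt_min hrb hδ)
  exact ⟨p, hp, hp'.trans_le (min_le_left _ _), h2 ⟨hp, hp'.trans_le (min_le_right _ _)⟩⟩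

/-- The right side makes countably many comparisons, all at rational times below `r`. This yields
both measurability and adaptedness of the contact sets. -/
lemma IsCadlag.exists_mem_lowPoints_iff {y : ℝ → ℝ} (hy : IsCadlag y) (s r : ℝ) :
    (∃ u ∈ lowPoints y, s < u ∧ u < r) ↔
      ∃ a b : ℚ, s < a ∧ (b : ℝ) < r ∧ ∀ s' : ℚ, s' ≤ a → ∀ n : ℕ, ∃ r' : ℚ, a ≤ r' ∧ r' ≤ b ∧
        y r' < y s' + 1 / (n + 1) := by
  constructor
  · rintro ⟨u, hu, hsu, hur⟩
    obtain ⟨a, ha, ha'⟩ := exists_rat_btwn hsu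
    obtain ⟨b, hb, hb'⟩ := exists_rat_btwn hur
    refine ⟨a, b, ha, hb', fun s' hs' n => ?_⟩
    have hs'a : (s' : ℝ) ≤ a := by exact_mod_cast hs'
    obtain ⟨r0, hr0, hr0'⟩ := hy.exists_lt_add_of_mem_lowPoints hu ha' (hs'a.trans ha'.le)
      (Nat.one_div_pos_of_nat (n := n))
    obtain ⟨p, hp, hp', hp''⟩ := hy.exists_rat_lt (hr0.2.trans_lt hb) hr0'
    exact ⟨p, by exact_mod_cast hr0.1.trans hp.le, by exact_mod_cast hp'.le, hp''⟩
  · rintro ⟨a, b, hsa, hbr, h⟩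
    by_contra! hcon
    have hdis : Disjoint (lowPoints y) (Icc (a : ℝ) b) := by
      refine disjoint_left.2 fun u hu hu' => ?_
      linarith [hcon u hu (hsa.trans_le hu'.1), hu'.2]
    obtain ⟨s0, hs0, ε, hε, hr⟩ := hy.exists_add_le_of_disjoint hdis
    obtain ⟨s', hs', hs''⟩ : ∃ s' : ℚ, s' ≤ a ∧ y s' < y s0 + ε / 2 := by
      rcases hs0.eq_or_lt with rfl | hlt
      · exact ⟨a, le_rfl, by linarith⟩
      · obtain ⟨p, -, hp, hp'⟩ := hy.exists_rat_lt (c := y s0 + ε / 2) hlt (by linarith)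
        exact ⟨p, by exact_mod_cast hp.le, hp'⟩
    obtain ⟨n, hn⟩ := exists_nat_one_div_lt (half_pos hε)
    obtain ⟨r', h1, h2, h3⟩ := h s' hs' n
    linarith [hr r' ⟨by exact_mod_cast h1, by exact_mod_cast h2⟩]

lemma contactSet_mono {x : ℝ → ℝ} (hx : IsCadlag x) : Monotone fun α => contactSet α x := by
  intro α β hαβ t ht
  simp only [contactSet_eq_lowPoints hx, lowPoints, hx.leftLim_sub_linear, min_sub_sub_right,
    mem_ofPred_eq] at ht ⊢
  intro s hs
  nlinarith [ht s hs]

/-! ### Contact sets after a time at which the path is at its infimum -/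

/-- The extension of a path on `[0, ∞)` by the linear function of slope `γ` on `(-∞, 0)`. -/
def extendPath (γ : ℝ) (z : NNReal → ℝ) (v : ℝ) : ℝ :=
  if 0 ≤ v then z v.toNNReal else γ * v

/-- The increments after time `d`. -/
def incrFrom (x : ℝ → ℝ) (d : ℝ) (u : NNReal) : ℝ := x (d + u) - x d

lemma extendPath_incrFrom_of_nonneg (x : ℝ → ℝ) (γ d : ℝ) {v : ℝ} (hv : 0 ≤ v) :
    extendPath γ (incrFrom x d) v = x (d + v) - x d := by
  simp [extendPath, incrFrom, hv]

lemma tendsto_extendPath_left {x : ℝ → ℝ} (hx : IsCadlag x) (γ d : ℝ) {v : ℝ} (hv : 0 < v) :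
    Tendsto (extendPath γ (incrFrom x d)) (𝓝[<] v)
      (𝓝 (Function.leftLim x (d + v) - x d)) := by
  have h1 : Tendsto (fun u => d + u) (𝓝[<] v) (𝓝[<] (d + v)) := by
    refine tendsto_nhdsWithin_iff.2 ⟨(continuous_const.add continuous_id).continuousWithinAt, ?_⟩
    filter_upwards [self_mem_nhdsWithin] with u hu using by simpa using hu
  refine (((hx.tendsto_leftLim _).comp h1).sub_const (x d)).congr' ?_
  filter_upwards [Ioo_mem_nhdsLT hv] with u hu
  simp [extendPath_incrFrom_of_nonneg x γ d hu.1.le]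

lemma isCadlag_extendPath {x : ℝ → ℝ} (hx : IsCadlag x) (γ d : ℝ) :
    IsCadlag (extendPath γ (incrFrom x d)) := by
  intro v
  have hneg (F : Filter ℝ) (hF : ∀ᶠ u in F, u < 0) (hF' : F ≤ 𝓝 v) :
      Tendsto (extendPath γ (incrFrom x d)) F (𝓝 (γ * v)) := by
    have : Tendsto (fun u => γ * u) F (𝓝 (γ * v)) :=
      ((continuous_const.mul continuous_id).tendsto v).mono_left hF'
    refine this.congr' ?_
    filter_upwards [hF] with u hu
    simp [extendPath, not_le.2 hu]
  rcases lt_trichotomy v 0 with hv | rfl | hv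
  · have hev : ∀ᶠ u in 𝓝 v, u < 0 := gt_mem_nhds hv
    refine ⟨?_, _, hneg _ (nhdsWithin_le_nhds hev) nhdsWithin_le_nhds⟩
    convert hneg _ (nhdsWithin_le_nhds hev) nhdsWithin_le_nhds using 2
    simp [extendPath, not_le.2 hv]
  · refine ⟨?_, _, hneg _ self_mem_nhdsWithin nhdsWithin_le_nhds⟩
    rw [extendPath_incrFrom_of_nonneg x γ d le_rfl]
    have h1 : Tendsto (fun u => d + u) (𝓝[>] 0) (𝓝[>] (d + 0)) := by
      refine tendsto_nhdsWithin_iff.2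
        ⟨(continuous_const.add continuous_id).continuousWithinAt, ?_⟩
      filter_upwards [self_mem_nhdsWithin] with u hu using by simpa using hu
    refine (((hx _).1.comp h1).sub_const (x d)).congr' ?_
    filter_upwards [self_mem_nhdsWithin] with u hu
    simp [extendPath_incrFrom_of_nonneg x γ d (le_of_lt hu)]
  · refine ⟨?_, _, tendsto_extendPath_left hx γ d hv⟩
    rw [extendPath_incrFrom_of_nonneg x γ d hv.le]
    have h1 : Tendsto (fun u => d + u) (𝓝[>] v) (𝓝[>] (d + v)) := by
      refine tendsto_nhdsWithin_iff.2
        ⟨(continuous_const.add continuous_id).continuousWithinAt, ?_⟩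
      filter_upwards [self_mem_nhdsWithin] with u hu using by simpa using hu
    refine (((hx _).1.comp h1).sub_const (x d)).congr' ?_
    filter_upwards [self_mem_nhdsWithin] with u hu
    simp [extendPath_incrFrom_of_nonneg x γ d (hv.le.trans (le_of_lt hu))]

/-- On both sides, comparison with times before the restart follows from comparison with the restart
time itself: on the left by `hd` and `β ≤ α`, on the right because the added line has slope `γ ≤ α`.
-/
lemma add_mem_contactSet_iff {x : ℝ → ℝ} (hx : IsCadlag x) {β γ α d u : ℝ} (hβ : β ≤ α)
    (hγ : γ ≤ α) (hd : ∀ s ≤ d, x d - β * d ≤ x s - β * s) (hu : 0 < u) :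
    d + u ∈ contactSet α x ↔ u ∈ contactSet α (extendPath γ (incrFrom x d)) := by
  have hz := isCadlag_extendPath hx γ d
  rw [contactSet_eq_lowPoints hx, contactSet_eq_lowPoints hz]
  simp only [lowPoints, mem_ofPred_eq, hx.leftLim_sub_linear, hz.leftLim_sub_linear,
    min_sub_sub_right]
  rw [leftLim_eq_of_tendsto (tendsto_extendPath_left hx γ d hu),
    extendPath_incrFrom_of_nonneg x γ d hu.le, min_sub_sub_right]
  constructor
  · intro h s hs
    rcases le_or_gt 0 s with hs0 | hs0
    · rw [extendPath_incrFrom_of_nonneg x γ d hs0]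
      nlinarith [h (d + s) (by linarith)]
    · rw [extendPath, if_neg (not_le.2 hs0)]
      nlinarith [h d (by linarith)]
  · intro h s hs
    rcases le_or_gt d s with hsd | hsd
    · have := h (s - d) (by linarith)
      rw [extendPath_incrFrom_of_nonneg x γ d (by linarith)] at this
      simp only [add_sub_cancel] at this
      nlinarith
    · have := h 0 hu.le
      rw [extendPath_incrFrom_of_nonneg x γ d le_rfl] at this
      simp only [add_zero, sub_self, mul_zero] at this
      nlinarith [hd s hsd.le]

lemma shift_contactSet {x : ℝ → ℝ} (hx : IsCadlag x) {β γ α d : ℝ} (hβ : β ≤ α)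
    (hγ : γ ≤ α) (hd : ∀ s ≤ d, x d - β * d ≤ x s - β * s) :
    shift d (contactSet α x) = shift 0 (contactSet α (extendPath γ (incrFrom x d))) := by
  refine Subtype.ext (Closeds.ext ?_)
  change closure _ = closure _
  congr 1
  ext u
  simp only [mem_image, mem_inter_iff, mem_Ioi, sub_zero, exists_eq_right]
  constructor
  · rintro ⟨s, ⟨hs, hds⟩, rfl⟩
    refine ⟨?_, by linarith⟩
    rw [← add_mem_contactSet_iff hx hβ hγ hd (by linarith)]
    simpa using hs
  · rintro ⟨hu, hu0⟩
    exact ⟨d + u, ⟨(add_mem_contactSet_iff hx hβ hγ hd hu0).2 hu, by linarith⟩, by ring⟩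

/-! ### Measurability on the space of closed sets -/

lemma nextPoint_lt_iff {t r : ℝ} {F : Set ℝ} :
    nextPoint t F < r ↔ ∃ s ∈ F, t < s ∧ s < r := by
  simp [nextPoint, sInf_lt_iff, and_assoc]

lemma coe_le_nextPoint (t : ℝ) (F : Set ℝ) : (t : EReal) ≤ nextPoint t F := by
  refine le_sInf ?_
  rintro _ ⟨s, hs, rfl⟩
  exact EReal.coe_le_coe_iff.2 (mem_Ioi.1 hs.2).le

lemma nextPoint_le {t s : ℝ} {F : Set ℝ} (hs : s ∈ F) (hts : t < s) : nextPoint t F ≤ s :=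
  sInf_le ⟨s, ⟨hs, hts⟩, rfl⟩

lemma nextPoint_mem {t d : ℝ} {F : Set ℝ} (hF : IsClosed F) (hd : nextPoint t F = d) : d ∈ F := by
  rw [← hF.closure_eq, Metric.mem_closure_iff]
  intro ε hε
  obtain ⟨s, hs, hts, hsd⟩ := nextPoint_lt_iff.1
    (show nextPoint t F < ((d + ε : ℝ) : EReal) by rw [hd]; exact_mod_cast lt_add_of_pos_right d hε)
  have : d ≤ s := by exact_mod_cast hd ▸ nextPoint_le hs hts
  refine ⟨s, hs, ?_⟩
  rw [dist_comm, Real.dist_eq, abs_of_nonneg (by linarith)]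
  linarith

lemma ereal_eq_of_lt_iff {a b : EReal} (h : ∀ r : ℝ, a < r ↔ b < r) : a = b :=
  le_antisymm (EReal.le_of_forall_lt_iff_le.1 fun r hr => ((h r).2 hr).le)
    (EReal.le_of_forall_lt_iff_le.1 fun r hr => ((h r).1 hr).le)

lemma coe_toReal_nextPoint {t : ℝ} {F : Set ℝ} (h : nextPoint t F < ⊤) :
    ((nextPoint t F).toReal : EReal) = nextPoint t F :=
  EReal.coe_toReal h.ne (ne_bot_of_le_ne_bot (EReal.coe_ne_bot t) (coe_le_nextPoint t F))

lemma measurable_ereal_of_lt {Ω : Type*} {m : MeasurableSpace Ω} {f : Ω → EReal}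
    (h : ∀ r : ℝ, MeasurableSet {ω | f ω < r}) : Measurable f := by
  refine measurable_of_Iio fun r => ?_
  induction r using EReal.rec with
  | bot => simp
  | coe r => exact h r
  | top =>
    have : f ⁻¹' Iio ⊤ = ⋃ n : ℕ, {ω | f ω < (n : ℝ)} := by
      ext ω
      simp only [mem_preimage, mem_Iio, mem_iUnion, mem_ofPred_eq]
      refine ⟨fun h => ?_, fun ⟨n, hn⟩ => hn.trans (EReal.coe_lt_top _)⟩
      obtain ⟨q, hq, -⟩ := EReal.lt_iff_exists_real_btwn.1 h
      obtain ⟨n, hn⟩ := exists_nat_gt q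
      exact ⟨n, hq.trans (by exact_mod_cast hn)⟩
    rw [this]
    exact MeasurableSet.iUnion fun n => h n

lemma nextPoint_eq_gap_add (t : ℝ) (F : Set ℝ) : nextPoint t F = gap t F + t := by
  rw [gap, EReal.sub_add_cancel]

lemma measurable_gap (t : ℝ) : Measurable fun F : Closeds ℝ => gap t (F : Set ℝ) :=
  (comap_measurable _).mono (le_iSup (fun t : ℝ => MeasurableSpace.comap
    (fun F : Closeds ℝ => gap t (F : Set ℝ)) inferInstance) t) le_rfl

lemma measurable_nextPoint (t : ℝ) : Measurable fun F : Closeds ℝ => nextPoint t (F : Set ℝ) := by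
  simp_rw [nextPoint_eq_gap_add]
  exact (measurable_gap t).add_const _

lemma measurable_closeds {Ω : Type*} {m : MeasurableSpace Ω} {f : Ω → Closeds ℝ}
    (h : ∀ t : ℝ, Measurable fun ω => nextPoint t (f ω : Set ℝ)) : Measurable f := by
  rw [measurable_iff_comap_le, instMeasurableSpaceCloseds, MeasurableSpace.comap_iSup]
  refine iSup_le fun t => ?_
  rw [MeasurableSpace.comap_comp, ← measurable_iff_comap_le]
  exact (h t).sub_const _

/-! ### Measurability of truncations and shifts. -/

/-- The condition `t < c` matters when `F` accumulates at `t` from the right: then `nextPoint t F =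
t`, but truncation at `c = t` leaves nothing after `t`. -/
lemma nextPoint_upTo (t : ℝ) (c : EReal) (F : Closeds ℝ) :
    nextPoint t (upTo c F : Set ℝ) =
      if (t : EReal) < c ∧ nextPoint t (F : Set ℝ) ≤ c then nextPoint t (F : Set ℝ) else ⊤ := by
  refine ereal_eq_of_lt_iff fun r => ?_
  have hl : nextPoint t (upTo c F : Set ℝ) < r ↔
      ∃ s ∈ (F : Set ℝ), (s : EReal) ≤ c ∧ t < s ∧ s < r := by
    simp only [nextPoint_lt_iff]
    exact exists_congr fun s => and_assoc
  rw [hl]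
  split_ifs with h
  · refine ⟨fun ⟨s, hs, _, h1, h2⟩ => nextPoint_lt_iff.2 ⟨s, hs, h1, h2⟩, fun hr => ?_⟩
    rcases h.2.lt_or_eq with hlt | heq
    · obtain ⟨q, hq, hq'⟩ := EReal.lt_iff_exists_real_btwn.1 (lt_min hr hlt)
      obtain ⟨s, hs, h1, h2⟩ := nextPoint_lt_iff.1 hq
      have h3 : (s : EReal) < min (r : EReal) c := (EReal.coe_lt_coe_iff.2 h2).trans hq'
      exact ⟨s, hs, (h3.trans_le (min_le_right _ _)).le, h1,
        by exact_mod_cast h3.trans_le (min_le_left _ _)⟩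
    · have hd := coe_toReal_nextPoint (hr.trans (EReal.coe_lt_top r))
      refine ⟨_, nextPoint_mem F.isClosed hd.symm, hd.le.trans h.2, ?_, ?_⟩
      · rw [← EReal.coe_lt_coe_iff, hd, heq]
        exact h.1
      · rwa [← EReal.coe_lt_coe_iff, hd]
  · simp only [not_top_lt, iff_false, not_exists, not_and]
    intro s hs hsc hts
    exact absurd ⟨(EReal.coe_lt_coe_iff.2 hts).trans_le hsc, (nextPoint_le hs hts).trans hsc⟩ h

lemma measurableSet_nextPointOf_lt_top {n : ℕ} (k : Fin n) (t : ℝ) :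
    MeasurableSet[pastOf k t] {F | nextPointOf k t F < ⊤} := by
  have h : Measurable[pastOf k t] (nextPointOf k t) :=
    (comap_measurable _).mono le_sup_left le_rfl
  exact h measurableSet_Iio

lemma measurable_nextPointOf {n : ℕ} (k : Fin n) (t : ℝ) : Measurable (nextPointOf k t) :=
  (measurable_nextPoint t).comp ((measurable_pi_apply k).comp measurable_subtype_coe)

lemma measurable_iff_pastOf_comap {Ω : Type*} {m : MeasurableSpace Ω} {n : ℕ} {k : Fin n} {t : ℝ}
    {M : Ω → Nested (Fin n)} (h1 : Measurable fun ω => nextPointOf k t (M ω))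
    (h2 : ∀ j s, Measurable fun ω =>
      nextPoint s (upTo (nextPointOf k t (M ω)) ((M ω).1 j) : Set ℝ)) :
    Measurable[m, pastOf k t] M := by
  rw [measurable_iff_comap_le, MeasurableSpace.comap_sup, MeasurableSpace.comap_iSup]
  refine sup_le ?_ (iSup_le fun j => ?_)
  · rw [MeasurableSpace.comap_comp, ← measurable_iff_comap_le]
    exact h1
  · rw [MeasurableSpace.comap_comp, ← measurable_iff_comap_le]
    exact measurable_closeds (h2 j)

lemma pastOf_le {n : ℕ} (k : Fin n) (t : ℝ) :
    pastOf k t ≤ (inferInstance : MeasurableSpace (Nested (Fin n))) := by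
  have h := measurable_iff_pastOf_comap (M := fun F : Nested (Fin n) => F) (k := k) (t := t)
    (measurable_nextPointOf k t) fun j s => by
      simp_rw [nextPoint_upTo]
      have hj : Measurable fun F : Nested (Fin n) => nextPoint s (F.1 j : Set ℝ) :=
        measurable_nextPointOf j s
      exact Measurable.ite ((measurableSet_lt measurable_const (measurable_nextPointOf k t)).inter
        (measurableSet_le hj (measurable_nextPointOf k t))) hj measurable_const
  exact fun s hs => h hs

/-- The maximum appears because the shift discards all points up to `t`. The closure is harmless,
since only open intervals are tested. -/
lemma nextPoint_shift (s t : ℝ) (F : Closeds ℝ) :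
    nextPoint s ((shift t (F : Set ℝ)).1 : Set ℝ) = nextPoint (t + max s 0) (F : Set ℝ) - t := by
  refine ereal_eq_of_lt_iff fun r => ?_
  rw [EReal.sub_lt_iff (by simp) (by simp), ← EReal.coe_add, nextPoint_lt_iff, nextPoint_lt_iff]
  constructor
  · rintro ⟨u, hu, hsu, hur⟩
    obtain ⟨v, ⟨hv1, hv2⟩, w, ⟨hw, htw⟩, rfl⟩ := mem_closure_iff.1 hu _ isOpen_Ioo ⟨hsu, hur⟩
    rw [mem_Ioi] at htw
    refine ⟨w, hw, ?_, by linarith⟩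
    rcases max_cases s 0 with h | h <;> linarith
  · rintro ⟨w, hw, h1, h2⟩
    have := le_max_left s 0
    have := le_max_right s 0
    exact ⟨w - t, subset_closure ⟨w, ⟨hw, by rw [mem_Ioi]; linarith⟩, rfl⟩, by linarith,
      by linarith⟩

lemma measurable_nextPoint_comp {Ω : Type*} {m : MeasurableSpace Ω} {T : Ω → ℝ}
    {f : Ω → Closeds ℝ} (hT : Measurable T) (hf : Measurable f) :
    Measurable fun ω => nextPoint (T ω) (f ω : Set ℝ) := by
  refine measurable_ereal_of_lt fun r => ?_
  have : {ω | nextPoint (T ω) (f ω : Set ℝ) < r} =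
      ⋃ a : ℚ, {ω | T ω < a} ∩ {ω | nextPoint a (f ω : Set ℝ) < r} := by
    ext ω
    simp only [nextPoint_lt_iff, mem_ofPred_eq, mem_iUnion, mem_inter_iff]
    constructor
    · rintro ⟨s, hs, h1, h2⟩
      obtain ⟨a, ha, ha'⟩ := exists_rat_btwn h1
      exact ⟨a, ha, s, hs, ha', h2⟩
    · rintro ⟨a, ha, s, hs, h1, h2⟩
      exact ⟨s, hs, ha.trans h1, h2⟩
  rw [this]
  exact MeasurableSet.iUnion fun a => (measurableSet_lt hT measurable_const).inter
    (measurableSet_lt ((measurable_nextPoint a).comp hf) measurable_const)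

lemma measurable_shift {Ω : Type*} {m : MeasurableSpace Ω} {T : Ω → ℝ} {f : Ω → Closeds ℝ}
    (hT : Measurable T) (hf : Measurable f) : Measurable fun ω => shift (T ω) (f ω : Set ℝ) := by
  refine Measurable.subtype_mk (measurable_closeds fun s => ?_)
  change Measurable fun ω => nextPoint s ((shift (T ω) (f ω : Set ℝ)).1 : Set ℝ)
  simp_rw [nextPoint_shift]
  exact (measurable_nextPoint_comp (hT.add_const _) hf).sub hT.coe_real_ereal

lemma measurable_futureOf {n : ℕ} (k : Fin n) (t : ℝ) :
    Measurable fun F : Nested (Fin n) => futureOf k (nextPointOf k t F).toReal F := by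
  refine Measurable.subtype_mk (measurable_pi_lambda _ fun j => ?_)
  exact measurable_shift (measurable_nextPointOf k t).ereal_toReal
    ((measurable_pi_apply _).comp measurable_subtype_coe)

lemma measurable_tailOf {n : ℕ} (k : Fin n) : Measurable (tailOf k) := by
  refine Measurable.subtype_mk (measurable_pi_lambda _ fun j => ?_)
  exact (measurable_pi_apply (j : Fin n)).comp measurable_subtype_coe

/-! ### Contact families of càdlàg paths -/

/-- The càdlàg paths, with the trace of the product `σ`-field. -/
abbrev CadlagPath : Type := {x : ℝ → ℝ // IsCadlag x}

/-- The increasing family of the contact sets of a càdlàg path. -/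
def contactFamily {n : ℕ} {α : Fin n → ℝ} (hα : Monotone α) (x : CadlagPath) : Nested (Fin n) :=
  ⟨fun i => ⟨contactSet (α i) x.1, by
      rw [contactSet_eq_lowPoints x.2]
      exact isClosed_lowPoints (x.2.sub_linear _)⟩,
    fun _ _ hij => contactSet_mono x.2 (hα hij)⟩

/-- Only differences at times below `r` enter, and the `σ`-field is arbitrary; it can therefore be
the one generated by the increments before `r`. -/
lemma measurableSet_nextPoint_contactSet_lt {Ω : Type*} {m : MeasurableSpace Ω}
    {X : ℝ → Ω → ℝ} (hX : ∀ ω, IsCadlag fun t => X t ω) {r : ℝ}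
    (hm : ∀ a < r, ∀ b < r, Measurable fun ω => X a ω - X b ω) (α s : ℝ) :
    MeasurableSet {ω | nextPoint s (contactSet α fun t => X t ω) < r} := by
  have : {ω | nextPoint s (contactSet α fun t => X t ω) < r} =
      ⋃ (a : ℚ) (b : ℚ) (_ : s < a) (_ : (b : ℝ) < r), ⋂ (s' : ℚ) (_ : s' ≤ a) (i : ℕ),
        ⋃ (r' : ℚ) (_ : a ≤ r') (_ : r' ≤ b),
          {ω | X r' ω - X s' ω < 1 / (i + 1) + α * r' - α * s'} := by
    ext ω
    simp only [mem_ofPred_eq, nextPoint_lt_iff, contactSet_eq_lowPoints (hX ω), mem_iUnion,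
      mem_iInter, IsCadlag.exists_mem_lowPoints_iff ((hX ω).sub_linear α), exists_prop]
    refine exists_congr fun a => exists_congr fun b => and_congr_right fun _ =>
      and_congr_right fun _ => forall_congr' fun s' => imp_congr_right fun _ =>
      forall_congr' fun i => exists_congr fun r' => and_congr_right fun _ =>
      and_congr_right fun _ => ⟨fun h => by linarith, fun h => by linarith⟩
  rw [this]
  refine MeasurableSet.iUnion fun a => MeasurableSet.iUnion fun b => MeasurableSet.iUnion fun _ =>
    MeasurableSet.iUnion fun hb => MeasurableSet.iInter fun s' => MeasurableSet.iInter fun hs' =>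
    MeasurableSet.iInter fun i => MeasurableSet.iUnion fun r' => MeasurableSet.iUnion fun ha =>
    MeasurableSet.iUnion fun hr' => ?_
  have h1 : (r' : ℝ) < r := lt_of_le_of_lt (by exact_mod_cast hr') hb
  have h2 : (s' : ℝ) < r := lt_of_le_of_lt (by exact_mod_cast hs'.trans ha) h1
  exact measurableSet_lt (hm _ h1 _ h2) measurable_const

lemma measurable_contactFamily {n : ℕ} {α : Fin n → ℝ} (hα : Monotone α) :
    Measurable (contactFamily hα) := by
  refine Measurable.subtype_mk (measurable_pi_lambda _ fun j => measurable_closeds fun s => ?_)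
  refine measurable_ereal_of_lt fun r => ?_
  exact measurableSet_nextPoint_contactSet_lt (X := fun t (x : CadlagPath) => x.1 t)
    (fun x => x.2) (fun a _ b _ => ((measurable_pi_apply a).comp measurable_subtype_coe).sub
      ((measurable_pi_apply b).comp measurable_subtype_coe)) _ _

/-! ### The Markov property of two-sided Lévy processes -/

/-- The `σ`-field generated by the increments of `X` before time `q`. -/
@[reducible]
def pastIncr {Ω : Type*} (X : ℝ → Ω → ℝ) (q : ℝ) : MeasurableSpace Ω :=
  ⨆ s : Iic q, MeasurableSpace.comap (fun ω => X s ω - X q ω) inferInstance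

/-- The path of the increments of `X` after a random time `T`. -/
def incrPath {Ω : Type*} (X : ℝ → Ω → ℝ) (T : Ω → ℝ) (ω : Ω) : NNReal → ℝ :=
  incrFrom (fun t => X t ω) (T ω)

lemma measurable_pastIncr_sub {Ω : Type*} (X : ℝ → Ω → ℝ) {a b q : ℝ} (ha : a ≤ q) (hb : b ≤ q) :
    Measurable[pastIncr X q] fun ω => X a ω - X b ω := by
  have h (s : ℝ) (hs : s ≤ q) : Measurable[pastIncr X q] fun ω => X s ω - X q ω :=
    (comap_measurable _).mono (le_iSup (fun s : Iic q => MeasurableSpace.comap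
      (fun ω => X s ω - X q ω) inferInstance) ⟨s, hs⟩) le_rfl
  convert (h a ha).sub (h b hb) using 1
  ext ω
  simp

lemma pastIncr_mono {Ω : Type*} (X : ℝ → Ω → ℝ) : Monotone (pastIncr X) := by
  intro p q hpq
  refine iSup_le fun s => ?_
  rw [← measurable_iff_comap_le]
  exact measurable_pastIncr_sub X (s.2.trans hpq) hpq

lemma exists_monotone_range_supset (K : Finset ℝ) :
    ∃ t : ℕ → ℝ, Monotone t ∧ ∀ x ∈ K, ∃ i, t i = x := by
  rcases K.eq_empty_or_nonempty with rfl | hK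
  · exact ⟨fun _ => 0, monotone_const, by simp⟩
  · have hc : 0 < K.card := hK.card_pos
    -- Capping the index makes the enumeration constant after the largest element.
    refine ⟨fun i => K.orderEmbOfFin rfl ⟨min i (K.card - 1), by omega⟩, ?_, ?_⟩
    · intro i j hij
      refine (K.orderEmbOfFin rfl).monotone ?_
      exact Fin.mk_le_mk.2 (min_le_min_right _ hij)
    · intro x hx
      obtain ⟨i, hi⟩ : x ∈ range (K.orderEmbOfFin rfl) := by simpa using hx
      refine ⟨i, hi ▸ congrArg _ (Fin.ext ?_)⟩
      have := i.2
      change min (i : ℕ) (K.card - 1) = i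
      omega

lemma comap_pi_le {Ω ι : Type*} {m : MeasurableSpace Ω} {Y : Ω → ι → ℝ}
    (h : ∀ i, Measurable fun ω => Y ω i) : MeasurableSpace.comap Y MeasurableSpace.pi ≤ m :=
  (measurable_pi_lambda _ h).comap_le

lemma process_sub_eq_sum {Ω : Type*} (X : ℝ → Ω → ℝ) (t : ℕ → ℝ) {a c : ℕ} (h : a ≤ c) (q : ℝ) (ω : Ω) :
    X (q + t c) ω - X (q + t a) ω =
      ∑ i ∈ Finset.Ico a c, (X (q + t (i + 1)) ω - X (q + t i) ω) :=
  (Finset.sum_Ico_sub (fun i => X (q + t i) ω) h).symm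

/-- The approximation of `x` from the right by multiples of `1 / (m + 1)`. -/
def gridAbove (m : ℕ) (x : ℝ) : ℝ := (⌊x * (m + 1)⌋ + 1) / (m + 1)

lemma lt_gridAbove (m : ℕ) (x : ℝ) : x < gridAbove m x := by
  rw [gridAbove, lt_div_iff₀ (by positivity)]
  exact Int.lt_floor_add_one _

lemma gridAbove_le (m : ℕ) (x : ℝ) : gridAbove m x ≤ x + 1 / (m + 1) := by
  rw [gridAbove, add_div]
  gcongr
  rw [div_le_iff₀ (by positivity)]
  exact Int.floor_le _

lemma tendsto_gridAbove (x u : ℝ) :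
    Tendsto (fun m => gridAbove m x + u) atTop (𝓝[>] (x + u)) := by
  refine tendsto_nhdsWithin_iff.2 ⟨?_, Eventually.of_forall fun m => by
    simpa using lt_gridAbove m x⟩
  refine Tendsto.add_const u (tendsto_of_tendsto_of_tendsto_of_le_of_le tendsto_const_nhds
    (by simpa using tendsto_const_nhds.add (tendsto_one_div_add_atTop_nhds_zero_nat (𝕜 := ℝ)))
    (fun m => (lt_gridAbove m x).le) fun m => gridAbove_le m x)

namespace IsTwoSidedLevy

variable {Ω : Type*} [mΩ : MeasurableSpace Ω] {μ : Measure Ω} {X : ℝ → Ω → ℝ}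

lemma pastIncr_le (hX : IsTwoSidedLevy X μ) (q : ℝ) : pastIncr X q ≤ mΩ := by
  refine iSup_le fun s => ?_
  rw [← measurable_iff_comap_le]
  exact (hX.measurable _).sub (hX.measurable _)

lemma measurable_comp (hX : IsTwoSidedLevy X μ) {T : Ω → ℝ} (hT : Measurable T) :
    Measurable fun ω => X (T ω) ω := by
  refine measurable_of_tendsto_metrizable (f := fun (m : ℕ) ω => X (gridAbove m (T ω)) ω)
    (fun m => ?_) (tendsto_pi_nhds.2 fun ω => ?_)
  · have h : Measurable fun p : ℤ × Ω => X ((p.1 + 1) / (m + 1)) p.2 :=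
      measurable_from_prod_countable_right fun i => hX.measurable ((i + 1) / (m + 1))
    exact h.comp (((hT.mul_const _).floor).prodMk measurable_id)
  · have := (hX.cadlag ω (T ω)).1.comp (by simpa using tendsto_gridAbove (T ω) 0)
    exact this

lemma measurable_incrPath (hX : IsTwoSidedLevy X μ) {T : Ω → ℝ} (hT : Measurable T) :
    Measurable (incrPath X T) :=
  measurable_pi_lambda _ fun _ =>
    (hX.measurable_comp (hT.add_const _)).sub (hX.measurable_comp hT)

/-- It suffices to treat finitely many times. List them with `q = t c` in one monotone sequence:
past increments are built from the steps with `i < c`, future ones from those with `c ≤ i`. -/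
lemma indepFun_incrPath [IsProbabilityMeasure μ] (hX : IsTwoSidedLevy X μ) (q : ℝ) :
    IndepFun (fun ω (s : Iic q) => X s ω - X q ω) (incrPath X fun _ => q) μ := by
  refine IndepFun.process_indepFun_process (X := fun (s : Iic q) ω => X s ω - X q ω)
    (Y := fun (u : NNReal) ω => X (q + u) ω - X q ω)
    (fun s => (hX.measurable _).sub (hX.measurable _))
    (fun s => (hX.measurable _).sub (hX.measurable _)) fun I J => ?_
  classical
  obtain ⟨t, ht, htK⟩ := exists_monotone_range_supset
    ({q} ∪ I.image (fun s : Iic q => (s : ℝ)) ∪ J.image (fun u : NNReal => q + (u : ℝ)))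
  obtain ⟨c, hc⟩ := htK q (by simp)
  have hξ : ∀ i, Measurable fun ω => X (t (i + 1)) ω - X (t i) ω :=
    fun i => (hX.measurable _).sub (hX.measurable _)
  have hind := indep_iSup_of_disjoint (fun i => (hξ i).comap_le) (hX.indep.nat ht).iIndep
    (S := {i | i < c}) (T := {i | c ≤ i})
    (disjoint_left.2 fun i hi hi' => absurd (show i < c from hi) (not_lt.2 hi'))
  have hmeas (S : Set ℕ) {a b : ℕ} (hab : ∀ i, a ≤ i → i < b → i ∈ S) (hle : a ≤ b) :
      Measurable[⨆ i ∈ S, MeasurableSpace.comap (fun ω => X (t (i + 1)) ω - X (t i) ω)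
        inferInstance] fun ω => X (t b) ω - X (t a) ω := by
    have : (fun ω => X (t b) ω - X (t a) ω) =
        fun ω => ∑ i ∈ Finset.Ico a b, (X (t (i + 1)) ω - X (t i) ω) := by
      ext ω
      simpa using process_sub_eq_sum X t hle 0 ω
    rw [this]
    refine Finset.measurable_fun_sum _ fun i hi => ?_
    rw [Finset.mem_Ico] at hi
    exact (comap_measurable _).mono (le_iSup₂_of_le i (hab i hi.1 hi.2) le_rfl) le_rfl
  refine indep_of_indep_of_le_left (indep_of_indep_of_le_right hind ?_) ?_
  · refine comap_pi_le fun u => ?_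
    obtain ⟨a, ha⟩ := htK (q + (u : NNReal)) (by
      simp only [Finset.mem_union, Finset.mem_image]
      exact Or.inr ⟨u, u.2, rfl⟩)
    rcases le_total c a with hca | hca
    · rw [← ha, ← hc]
      exact hmeas _ (fun i h _ => h) hca
    -- A repeated time may carry an index on the wrong side of `c`; monotonicity then forces it to
    -- equal `q`, and the increment vanishes.
    · have h1 : q + ((u : NNReal) : ℝ) = q :=
        le_antisymm (ha ▸ hc ▸ ht hca) (by simp)
      rw [h1]
      simp
  · refine comap_pi_le fun s => ?_
    obtain ⟨a, ha⟩ := htK (s : Iic q) (by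
      simp only [Finset.mem_union, Finset.mem_image]
      exact Or.inl (Or.inr ⟨s, s.2, rfl⟩))
    rcases le_total a c with hca | hca
    · rw [← ha, ← hc]
      convert (hmeas {i | i < c} (fun i _ h => h) hca).neg using 1
      ext ω
      simp
    · have h1 : ((s : Iic q) : ℝ) = q := le_antisymm s.1.2 (ha ▸ hc ▸ ht hca)
      rw [h1]
      simp

lemma indep_pastIncr [IsProbabilityMeasure μ] (hX : IsTwoSidedLevy X μ) (q : ℝ) :
    Indep (pastIncr X q) (MeasurableSpace.comap (incrPath X fun _ => q) inferInstance) μ := by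
  refine indep_of_indep_of_le_left (hX.indepFun_incrPath q) ?_
  refine iSup_le fun s => ?_
  rw [← measurable_iff_comap_le]
  exact (show Measurable fun z : Iic q → ℝ => z s from measurable_pi_apply s).comp
    (comap_measurable _)

lemma map_incrPath_const [IsProbabilityMeasure μ] (hX : IsTwoSidedLevy X μ) (q : ℝ) :
    μ.map (incrPath X fun _ => q) = μ.map (incrPath X fun _ => 0) := by
  refine (map_eq_iff_forall_finset_map_restrict_eq
    (X := fun (u : NNReal) ω => X (q + u) ω - X q ω)
    (Y := fun (u : NNReal) ω => X (0 + u) ω - X 0 ω)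
    (hX.measurable_incrPath measurable_const).aemeasurable
    (hX.measurable_incrPath measurable_const).aemeasurable).2 fun J => ?_
  classical
  obtain ⟨t, ht, htK⟩ := exists_monotone_range_supset ({0} ∪ J.image (fun u : NNReal => (u : ℝ)))
  obtain ⟨c, hc⟩ := htK 0 (by simp)
  have hex (u : J) : ∃ a, c ≤ a ∧ t a = ((u : NNReal) : ℝ) := by
    obtain ⟨a, ha⟩ := htK (u : NNReal) (by
      simp only [Finset.mem_union, Finset.mem_image]
      exact Or.inr ⟨u, u.2, rfl⟩)
    rcases le_total c a with hca | hca
    · exact ⟨a, hca, ha⟩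
    · exact ⟨c, le_rfl, le_antisymm (hc ▸ NNReal.coe_nonneg _) (ha ▸ ht hca)⟩
  choose a hca ha using hex
  let g (z : ℕ → ℝ) (u : J) : ℝ := ∑ i ∈ Finset.Ico c (a u), z i
  have hg : Measurable g := measurable_pi_lambda _ fun u =>
    Finset.measurable_fun_sum _ fun i _ => measurable_pi_apply i
  have hξ (p : ℝ) : Measurable fun ω (i : ℕ) => X (p + t (i + 1)) ω - X (p + t i) ω :=
    measurable_pi_lambda _ fun i => (hX.measurable _).sub (hX.measurable _)
  have hgξ (p : ℝ) : (fun ω => J.restrict fun u : NNReal => X (p + u) ω - X p ω) =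
      g ∘ fun ω (i : ℕ) => X (p + t (i + 1)) ω - X (p + t i) ω := by
    ext ω u
    have := process_sub_eq_sum X t (hca u) p ω
    rw [ha, hc, add_zero] at this
    exact this
  change μ.map (fun ω => J.restrict fun u : NNReal => X (q + u) ω - X q ω) =
    μ.map (fun ω => J.restrict fun u : NNReal => X (0 + u) ω - X 0 ω)
  rw [hgξ, hgξ, ← Measure.map_map hg (hξ q), ← Measure.map_map hg (hξ 0)]
  congr 1
  -- Independence makes the law of the steps a product, and stationarity makes its factors depend on
  -- the step lengths only, hence not on `p`.
  have hlaw (p : ℝ) : μ.map (fun ω (i : ℕ) => X (p + t (i + 1)) ω - X (p + t i) ω) =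
      Measure.infinitePi fun i : ℕ => μ.map fun ω => X (t (i + 1) - t i) ω - X 0 ω := by
    have h1 := hX.indep.nat (t := fun i => p + t i) (ht.const_add p)
    rw [iIndepFun_iff_map_fun_eq_infinitePi_map₀ (hξ p).aemeasurable] at h1
    rw [h1]
    congr 1
    ext1 i
    have h2 := (hX.stationary (p + t i) (t (i + 1) - t i)
      (sub_nonneg.2 (ht (Nat.le_succ i)))).map_eq
    rw [← h2, add_assoc, add_sub_cancel]
  rw [hlaw, hlaw]

lemma measure_inter_incrPath_const [IsProbabilityMeasure μ] (hX : IsTwoSidedLevy X μ) {q : ℝ}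
    {A : Set Ω} (hA : MeasurableSet[pastIncr X q] A) {B : Set (NNReal → ℝ)}
    (hB : MeasurableSet B) :
    μ (A ∩ incrPath X (fun _ => q) ⁻¹' B) = μ A * μ.map (incrPath X fun _ => 0) B := by
  rw [← hX.map_incrPath_const q, Measure.map_apply (hX.measurable_incrPath measurable_const) hB]
  exact (Indep_iff _ _ μ).1 (hX.indep_pastIncr q) _ _ hA ⟨B, hB, rfl⟩

lemma measurableSet_of_forall_lt (hX : IsTwoSidedLevy X μ) {G : Set Ω} {T : Ω → ℝ}
    (hG : ∀ q, MeasurableSet[pastIncr X q] (G ∩ {ω | T ω < q})) : MeasurableSet G := by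
  have : G = ⋃ n : ℕ, G ∩ {ω | T ω < n} := by
    rw [← inter_iUnion, eq_comm, inter_eq_left]
    intro ω _
    exact mem_iUnion.2 (exists_nat_gt (T ω))
  rw [this]
  exact MeasurableSet.iUnion fun n => hX.pastIncr_le _ _ (hG n)

/-- The approximating time has countably many values, so the Markov property at fixed times can be
summed over grid cells. -/
lemma map_incrPath_gridAbove [IsProbabilityMeasure μ] (hX : IsTwoSidedLevy X μ) {G : Set Ω}
    {T : Ω → ℝ} (hT : Measurable T) (hG : ∀ q, MeasurableSet[pastIncr X q] (G ∩ {ω | T ω < q}))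
    (m : ℕ) :
    (μ.restrict G).map (incrPath X fun ω => gridAbove m (T ω)) =
      μ G • μ.map (incrPath X fun _ => 0) := by
  have hGm := hX.measurableSet_of_forall_lt hG
  have hTm : Measurable fun ω => gridAbove m (T ω) := by
    unfold gridAbove
    have : Measurable fun ω => (⌊T ω * (m + 1)⌋ : ℝ) :=
      measurable_from_top.comp (hT.mul_const _).floor
    exact (this.add_const _).div_const _
  have hm : (0 : ℝ) < m + 1 := by positivity
  let A (i : ℤ) : Set Ω := G ∩ {ω | ⌊T ω * (m + 1)⌋ = i}
  have hA (i : ℤ) : MeasurableSet[pastIncr X ((i + 1) / (m + 1))] (A i) := by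
    -- Only strict events `T < q` are known to be in the past, so the cells are half-open on the
    -- right and the grid point lies strictly above `T`.
    have : A i = (G ∩ {ω | T ω < (i + 1) / (m + 1)}) \ (G ∩ {ω | T ω < i / (m + 1)}) := by
      ext ω
      simp only [A, mem_inter_iff, mem_ofPred_eq, Set.mem_sdiff, Int.floor_eq_iff, lt_div_iff₀ hm]
      constructor
      · rintro ⟨h1, h2, h3⟩
        exact ⟨⟨h1, h3⟩, fun h => absurd h.2 (not_lt.2 h2)⟩
      · rintro ⟨⟨h1, h2⟩, h3⟩
        exact ⟨h1, not_lt.1 fun h => h3 ⟨h1, h⟩, h2⟩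
    rw [this]
    refine (hG _).diff (pastIncr_mono X ?_ _ (hG _))
    gcongr
    linarith
  have hAG : G = ⋃ i, A i := by simp [A, ← inter_iUnion, iUnion_eq_univ_iff.2]
  have hdis : Pairwise (Function.onFun Disjoint A) := by
    intro i j hij
    refine disjoint_left.2 fun ω hi hj => hij ?_
    exact hi.2.symm.trans hj.2
  have hAm (i : ℤ) : MeasurableSet (A i) := hX.pastIncr_le _ _ (hA i)
  ext B hB
  rw [Measure.map_apply (hX.measurable_incrPath hTm) hB,
    Measure.restrict_apply (hX.measurable_incrPath hTm hB), Measure.smul_apply, smul_eq_mul]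
  have hpre (i : ℤ) : (incrPath X fun ω => gridAbove m (T ω)) ⁻¹' B ∩ A i =
      A i ∩ (incrPath X fun _ => ((i + 1) / (m + 1) : ℝ)) ⁻¹' B := by
    rw [inter_comm]
    ext ω
    refine and_congr_right fun hω => ?_
    have : gridAbove m (T ω) = (i + 1) / (m + 1) := by rw [gridAbove, hω.2]
    simp only [mem_preimage, incrPath, this]
  have h1 : (incrPath X fun ω => gridAbove m (T ω)) ⁻¹' B ∩ G =
      ⋃ i, A i ∩ (incrPath X fun _ => ((i + 1) / (m + 1) : ℝ)) ⁻¹' B := by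
    conv_lhs => rw [hAG, inter_iUnion]
    exact iUnion_congr hpre
  rw [h1, measure_iUnion (fun i j hij => (hdis hij).mono inter_subset_left inter_subset_left)
    fun i => (hAm i).inter (hX.measurable_incrPath measurable_const hB)]
  simp_rw [hX.measure_inter_incrPath_const (hA _) hB]
  rw [ENNReal.tsum_mul_right, ← measure_iUnion hdis hAm, ← hAG]

/-- The strong Markov property: after a random time `T`, on an event `G` of the past of `T`, the
process starts afresh. -/
theorem map_incrPath [IsProbabilityMeasure μ] (hX : IsTwoSidedLevy X μ) {G : Set Ω}
    {T : Ω → ℝ} (hT : Measurable T)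
    (hG : ∀ q, MeasurableSet[pastIncr X q] (G ∩ {ω | T ω < q})) :
    (μ.restrict G).map (incrPath X T) = μ G • μ.map (incrPath X fun _ => 0) := by
  have hTm (m : ℕ) : Measurable fun ω => gridAbove m (T ω) := by
    unfold gridAbove
    have : Measurable fun ω => (⌊T ω * (m + 1)⌋ : ℝ) :=
      measurable_from_top.comp (hT.mul_const _).floor
    exact (this.add_const _).div_const _
  have : IsFiniteMeasure (μ G • μ.map (incrPath X fun _ => 0)) :=
    Measure.smul_finite _ (measure_ne_top μ G)
  -- Finite-dimensional laws determine the law on path space, and bounded continuous functions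
  -- determine those; right continuity then lets the mesh tend to zero.
  refine IsProjectiveLimit.unique
    (P := fun I : Finset NNReal => ((μ.restrict G).map (incrPath X T)).map I.restrict)
    (fun I => rfl) fun I => ?_
  refine ext_of_forall_integral_eq_of_IsFiniteMeasure fun h => ?_
  have hres : Measurable (I.restrict : (NNReal → ℝ) → (I → ℝ)) := Finset.measurable_restrict _
  have hh : Measurable fun z : NNReal → ℝ => h (I.restrict z) := h.continuous.measurable.comp hres
  have hconst (m : ℕ) : ∫ ω in G, h (I.restrict (incrPath X (fun ω => gridAbove m (T ω)) ω)) ∂μ =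
      ∫ x, h x ∂(μ G • μ.map (incrPath X fun _ => 0)).map I.restrict := by
    rw [← hX.map_incrPath_gridAbove hT hG m,
      integral_map hres.aemeasurable h.continuous.aestronglyMeasurable,
      integral_map (hX.measurable_incrPath (hTm m)).aemeasurable hh.aestronglyMeasurable]
  rw [integral_map hres.aemeasurable h.continuous.aestronglyMeasurable (μ := (μ.restrict G).map _),
    integral_map (hX.measurable_incrPath hT).aemeasurable hh.aestronglyMeasurable]
  have hlim := tendsto_integral_of_dominated_convergence (μ := μ.restrict G)
    (F := fun (m : ℕ) ω => h (I.restrict (incrPath X (fun ω => gridAbove m (T ω)) ω)))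
    (f := fun ω => h (I.restrict (incrPath X T ω))) (fun _ => ‖h‖)
    (fun m => (hh.comp (hX.measurable_incrPath (hTm m))).aestronglyMeasurable)
    (integrable_const _) (fun m => Eventually.of_forall fun ω => h.norm_coe_le_norm _)
    (Eventually.of_forall fun ω => ?_)
  · simp_rw [hconst] at hlim
    exact tendsto_nhds_unique tendsto_const_nhds hlim
  · refine (h.continuous.tendsto _).comp (tendsto_pi_nhds.2 fun u => ?_)
    have h1 := (hX.cadlag ω (T ω + (u : NNReal))).1.comp (tendsto_gridAbove (T ω) (u : NNReal))
    have h2 := (hX.cadlag ω (T ω + 0)).1.comp (tendsto_gridAbove (T ω) 0)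
    simp only [add_zero] at h2
    exact h1.sub h2

end IsTwoSidedLevy

/-! ### A Lévy process does not jump upwards from its infimum at the end of a gap -/

lemma le_of_nextPoint_eq_self {y : ℝ → ℝ} (hy : IsCadlag y) {t s : ℝ}
    (h : nextPoint t (lowPoints y) = t) (hs : s ≤ t) : y t ≤ y s := by
  by_contra! hlt
  obtain ⟨c, hc, hc'⟩ := exists_between hlt
  obtain ⟨δ, hδ, h1⟩ := mem_nhdsGT_iff_exists_Ioo_subset.1
    ((hy t).1.eventually (lt_mem_nhds hc'))
  obtain ⟨u, hu, htu, huδ⟩ := nextPoint_lt_iff.1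
    (show nextPoint t (lowPoints y) < ((δ : ℝ) : EReal) by
      rw [h]; exact EReal.coe_lt_coe_iff.2 hδ)
  have h2 : c ≤ Function.leftLim y u := by
    refine ge_of_tendsto (hy.tendsto_leftLim u) ?_
    filter_upwards [Ioo_mem_nhdsLT htu] with v hv
    exact (h1 ⟨hv.1, hv.2.trans huδ⟩).le
  have h3 : c < y u := h1 ⟨htu, huδ⟩
  exact absurd (hu s (hs.trans htu.le)) (not_le.2 (hc.trans_le (le_min h3.le h2)))

/-! ### Announcing the end of a gap. -/

/-- The rational times after `q` at which the path exceeds its infimum up to time `q` by at most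
`1 / (n + 1)`. -/
def nearInf (y : ℝ → ℝ) (q : ℚ) (n : ℕ) : Set ℝ :=
  (fun s : ℚ => (s : ℝ)) '' {s : ℚ | q < s ∧ ∀ s' : ℚ, s' ≤ q → y s ≤ y s' + 1 / (n + 1)}

lemma bddBelow_nearInf (y : ℝ → ℝ) (q : ℚ) (n : ℕ) : BddBelow (nearInf y q n) := by
  refine ⟨q, ?_⟩
  rintro _ ⟨s, hs, rfl⟩
  exact Rat.cast_le.2 hs.1.le

lemma nearInf_nonempty {y : ℝ → ℝ} (hy : IsCadlag y) {q : ℚ} {d : ℝ} (hqd : q < d)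
    (hmin : ∀ s ≤ d, Function.leftLim y d ≤ y s) (n : ℕ) :
    (nearInf y q n).Nonempty ∧ sInf (nearInf y q n) < d := by
  have hn : (0 : ℝ) < 1 / (n + 1) := Nat.one_div_pos_of_nat
  obtain ⟨r, hr, hr1, hr2⟩ := (((hy.tendsto_leftLim d).eventually
    (gt_mem_nhds (lt_add_of_pos_right _ hn))).and (Ioo_mem_nhdsLT hqd)).exists
  obtain ⟨s, hs1, hs2, hs3⟩ := hy.exists_rat_lt hr2 hr
  have hmem : (s : ℝ) ∈ nearInf y q n := by
    refine ⟨s, ⟨by exact_mod_cast hr1.trans hs1, fun s' hs' => ?_⟩, rfl⟩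
    have : (s' : ℝ) ≤ d := le_trans (by exact_mod_cast hs') hqd.le
    linarith [hmin s' this]
  exact ⟨⟨_, hmem⟩, (csInf_le (bddBelow_nearInf y q n) hmem).trans_lt hs2⟩

/-- Up to any `e' < d` the gap keeps the path some `ε` above a value taken by time `q`, so no time
within a smaller tolerance of the old infimum can occur there. -/
lemma tendsto_sInf_nearInf {y : ℝ → ℝ} (hy : IsCadlag y) {q : ℚ} {d : ℝ} (hqd : q < d)
    (hmin : ∀ s ≤ d, Function.leftLim y d ≤ y s)
    (hdis : Disjoint (lowPoints y) (Ico (q : ℝ) d)) :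
    Tendsto (fun n => sInf (nearInf y q n)) atTop (𝓝[<] d) := by
  refine tendsto_nhdsWithin_iff.2 ⟨tendsto_order.2 ⟨fun e he => ?_, fun e he => ?_⟩,
    Eventually.of_forall fun n => (nearInf_nonempty hy hqd hmin n).2⟩
  · obtain ⟨e', he', hed⟩ := exists_between (max_lt he hqd)
    obtain ⟨s0, hs0, ε, hε, hr⟩ := hy.exists_add_le_of_disjoint (a := (q : ℝ)) (b := e')
      (hdis.mono_right (Icc_subset_Ico_right hed))
    obtain ⟨s1, hs1, hs1'⟩ : ∃ s1 : ℚ, s1 ≤ q ∧ y s1 < y s0 + ε / 2 := by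
      rcases hs0.eq_or_lt with rfl | hlt
      · exact ⟨q, le_rfl, by linarith⟩
      · obtain ⟨p, -, hp, hp'⟩ := hy.exists_rat_lt (c := y s0 + ε / 2) hlt (by linarith)
        exact ⟨p, by exact_mod_cast hp.le, hp'⟩
    filter_upwards [(tendsto_one_div_add_atTop_nhds_zero_nat (𝕜 := ℝ)).eventually
      (gt_mem_nhds (half_pos hε))] with n hn
    refine ((le_max_left _ _).trans_lt he').trans_le
      (le_csInf (nearInf_nonempty hy hqd hmin n).1 ?_)
    rintro _ ⟨s, ⟨hqs, hs⟩, rfl⟩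
    by_contra! hlt
    linarith [hs s1 hs1, hr s ⟨by exact_mod_cast hqs.le, hlt.le⟩]
  · exact Eventually.of_forall fun n => ((nearInf_nonempty hy hqd hmin n).2).trans he

/-- The paths that exceed `ε` at a rational time in `[0, δ)`. -/
def fastPaths (ε δ : ℝ) : Set (NNReal → ℝ) :=
  ⋃ (u : ℚ) (_ : 0 ≤ u) (_ : (u : ℝ) < δ), {z | ε < z (u : ℝ).toNNReal}

lemma measurableSet_fastPaths (ε δ : ℝ) : MeasurableSet (fastPaths ε δ) :=
  MeasurableSet.iUnion fun _ => MeasurableSet.iUnion fun _ => MeasurableSet.iUnion fun _ =>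
    measurableSet_lt measurable_const (measurable_pi_apply _)

lemma fastPaths_mono (ε : ℝ) : Monotone (fastPaths ε) := by
  intro δ δ' h z hz
  simp only [fastPaths, mem_iUnion] at hz ⊢
  obtain ⟨u, h0, hu, hz⟩ := hz
  exact ⟨u, h0, hu.trans_le h, hz⟩

lemma incrFrom_mem_fastPaths {x : ℝ → ℝ} (hx : IsCadlag x) {T d ε δ : ℝ} (hTd : T < d)
    (hdT : d < T + δ) (h : x T + ε < x d) : incrFrom x T ∈ fastPaths ε δ := by
  obtain ⟨η, hη, h1⟩ := mem_nhdsGT_iff_exists_Ioo_subset.1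
    ((hx d).1.eventually (lt_mem_nhds h))
  have hη : d < η := hη
  obtain ⟨u, hu, hu'⟩ := exists_rat_btwn
    (lt_min (show d - T < η - T by linarith) (show d - T < δ by linarith))
  rw [lt_min_iff] at hu'
  have hu0 : (0 : ℝ) ≤ u := by linarith
  simp only [fastPaths, mem_iUnion]
  refine ⟨u, by exact_mod_cast hu0, hu'.2, ?_⟩
  have : x T + ε < x (T + u) := h1 ⟨by linarith, by linarith⟩
  simp only [mem_ofPred_eq, incrFrom, Real.coe_toNNReal _ hu0]
  linarith

lemma incrFrom_notMem_fastPaths {x : ℝ → ℝ} (hx : IsCadlag x) (T : ℝ) {ε : ℝ} (hε : 0 < ε) :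
    ∃ δ > 0, incrFrom x T ∉ fastPaths ε δ := by
  obtain ⟨η, hη, h1⟩ := mem_nhdsGT_iff_exists_Ioo_subset.1
    ((hx T).1.eventually (gt_mem_nhds (lt_add_of_pos_right _ hε)))
  have hη : T < η := hη
  refine ⟨η - T, by linarith, fun h => ?_⟩
  simp only [fastPaths, mem_iUnion] at h
  obtain ⟨u, h0, hu, hz⟩ := h
  have hu0 : (0 : ℝ) ≤ u := by exact_mod_cast h0
  simp only [mem_ofPred_eq, incrFrom, Real.coe_toNNReal _ hu0] at hz
  rcases hu0.eq_or_lt with h | h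
  · rw [← h, add_zero] at hz
    linarith
  · have : x (T + u) < x T + ε := h1 ⟨by linarith, by linarith⟩
    linarith

lemma measurableSet_nearInf {Ω : Type*} (X : ℝ → Ω → ℝ) (α : ℝ) (q : ℚ) (n : ℕ) (r : ℝ) :
    MeasurableSet[pastIncr X r] ({ω | (nearInf (fun s => X s ω - α * s) q n).Nonempty} ∩
      {ω | sInf (nearInf (fun s => X s ω - α * s) q n) < r}) := by
  have : ({ω | (nearInf (fun s => X s ω - α * s) q n).Nonempty} ∩
      {ω | sInf (nearInf (fun s => X s ω - α * s) q n) < r}) =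
      ⋃ (s : ℚ) (_ : q < s) (_ : (s : ℝ) < r), ⋂ (s' : ℚ) (_ : s' ≤ q),
        {ω | X s ω - X s' ω ≤ 1 / (n + 1) + α * s - α * s'} := by
    ext ω
    simp only [mem_inter_iff, mem_ofPred_eq, mem_iUnion, mem_iInter, exists_prop]
    constructor
    · rintro ⟨hne, hlt⟩
      obtain ⟨_, ⟨s, ⟨hqs, hs⟩, rfl⟩, hsr⟩ := (csInf_lt_iff (bddBelow_nearInf _ q n) hne).1 hlt
      exact ⟨s, hqs, hsr, fun s' hs' => by linarith [hs s' hs']⟩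
    · rintro ⟨s, hqs, hsr, hs⟩
      have hmem : (s : ℝ) ∈ nearInf (fun s => X s ω - α * s) q n :=
        ⟨s, ⟨hqs, fun s' hs' => by linarith [hs s' hs']⟩, rfl⟩
      exact ⟨⟨_, hmem⟩, (csInf_le (bddBelow_nearInf _ q n) hmem).trans_lt hsr⟩
  rw [this]
  refine @MeasurableSet.iUnion _ _ (pastIncr X r) _ _ fun s =>
    @MeasurableSet.iUnion _ _ (pastIncr X r) _ _ fun hqs =>
    @MeasurableSet.iUnion _ _ (pastIncr X r) _ _ fun hsr =>
    @MeasurableSet.iInter _ _ (pastIncr X r) _ _ fun s' =>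
    @MeasurableSet.iInter _ _ (pastIncr X r) _ _ fun hs' => ?_
  have hs'r : (s' : ℝ) ≤ r := le_trans (by exact_mod_cast hs'.trans hqs.le) hsr.le
  exact (measurable_pastIncr_sub X hsr.le hs'r) measurableSet_Iic

namespace IsTwoSidedLevy

variable {Ω : Type*} [mΩ : MeasurableSpace Ω] {μ : Measure Ω} {X : ℝ → Ω → ℝ}

lemma measurable_sInf_nearInf (hX : IsTwoSidedLevy X μ) (α : ℝ) (q : ℚ) (n : ℕ) :
    Measurable fun ω => sInf (nearInf (fun s => X s ω - α * s) q n) := by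
  have hne : MeasurableSet {ω | (nearInf (fun s => X s ω - α * s) q n).Nonempty} :=
    hX.measurableSet_of_forall_lt (measurableSet_nearInf X α q n)
  refine measurable_of_Iio fun r => ?_
  -- When no such time exists, `sInf ∅ = 0` decides the event, which accounts for the second piece.
  have : (fun ω => sInf (nearInf (fun s => X s ω - α * s) q n)) ⁻¹' Iio r =
      ({ω | (nearInf (fun s => X s ω - α * s) q n).Nonempty} ∩
        {ω | sInf (nearInf (fun s => X s ω - α * s) q n) < r}) ∪
      ({ω | (nearInf (fun s => X s ω - α * s) q n).Nonempty}ᶜ ∩ {_ω | 0 < r}) := by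
    ext ω
    by_cases h : (nearInf (fun s => X s ω - α * s) q n).Nonempty
    · simp [h]
    · simp [not_nonempty_iff_eq_empty.1 h]
  rw [this]
  exact (hX.pastIncr_le r _ (measurableSet_nearInf X α q n r)).union
    (hne.compl.inter (MeasurableSet.const _))

lemma tendsto_measure_fastPaths [IsProbabilityMeasure μ] (hX : IsTwoSidedLevy X μ) {ε : ℝ}
    (hε : 0 < ε) :
    Tendsto (fun m : ℕ => μ.map (incrPath X fun _ => 0) (fastPaths ε (1 / (m + 1)))) atTop
      (𝓝 0) := by
  have hZ : Measurable (incrPath X fun _ => 0) := hX.measurable_incrPath measurable_const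
  have h := tendsto_measure_iInter_atTop (μ := μ)
    (s := fun m : ℕ => (incrPath X fun _ => 0) ⁻¹' fastPaths ε (1 / (m + 1)))
    (fun m => (hZ (measurableSet_fastPaths _ _)).nullMeasurableSet)
    (fun i j hij => preimage_mono (fastPaths_mono ε (Nat.one_div_le_one_div hij)))
    ⟨0, measure_ne_top _ _⟩
  have hemp : ⋂ m : ℕ, (incrPath X fun _ => 0) ⁻¹' fastPaths ε (1 / ((m : ℝ) + 1)) = ∅ := by
    refine eq_empty_iff_forall_notMem.2 fun ω hω => ?_
    obtain ⟨δ, hδ, hδ'⟩ := incrFrom_notMem_fastPaths (hX.cadlag ω) 0 hε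
    obtain ⟨m, hm⟩ := exists_nat_one_div_lt hδ
    exact hδ' (fastPaths_mono ε hm.le (mem_iInter.1 hω m))
  rw [hemp, measure_empty] at h
  refine h.congr fun m => ?_
  rw [Measure.map_apply hZ (measurableSet_fastPaths _ _)]
  rfl

/-- The event that the first low point after `q` is the time of an upward jump larger than `ε`. -/
def jumpEvent (X : ℝ → Ω → ℝ) (α : ℝ) (q : ℚ) (ε : ℝ) : Set Ω :=
  {ω | ∃ d : ℝ, q < d ∧ d ∈ lowPoints (fun s => X s ω - α * s) ∧
    Disjoint (lowPoints fun s => X s ω - α * s) (Ico (q : ℝ) d) ∧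
    Function.leftLim (fun s => X s ω) d + ε < X d ω}

/-- On this event the announcing times `T n` are eventually within `1 / (m + 1)` of `d`, and the
path rises by more than `ε` from `T n` to `d`. The strong Markov property bounds the probability by
that of a fast rise after `0`, which vanishes as `m` grows. -/
lemma measure_jumpEvent [IsProbabilityMeasure μ] (hX : IsTwoSidedLevy X μ) (α : ℝ) (q : ℚ)
    {ε : ℝ} (hε : 0 < ε) : μ (jumpEvent X α q ε) = 0 := by
  let T (n : ℕ) (ω : Ω) : ℝ := sInf (nearInf (fun s => X s ω - α * s) q n)
  let G (n : ℕ) : Set Ω := {ω | (nearInf (fun s => X s ω - α * s) q n).Nonempty}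
  have hT (n) : Measurable (T n) := hX.measurable_sInf_nearInf α q n
  have hsub (m : ℕ) : jumpEvent X α q ε ⊆ ⋃ N : ℕ, ⋂ (n : ℕ) (_ : N ≤ n),
      (G n ∩ incrPath X (T n) ⁻¹' fastPaths ε (1 / (m + 1))) := by
    rintro ω ⟨d, hqd, hd, hdis, hjump⟩
    have hy := (hX.cadlag ω).sub_linear α
    -- Since the jump is upward, the minimum of value and left limit is the left limit.
    have hmin : ∀ s ≤ d, Function.leftLim (fun s => X s ω - α * s) d ≤ X s ω - α * s := by
      intro s hs
      refine (min_le_iff.1 (hd s hs)).elim (fun h => le_trans ?_ h) id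
      rw [(hX.cadlag ω).leftLim_sub_linear]
      linarith
    have hlim := tendsto_sInf_nearInf hy hqd hmin hdis
    have h1 := (((hX.cadlag ω).tendsto_leftLim d).comp hlim).eventually
      (gt_mem_nhds (show _ < X d ω - ε by linarith))
    have h2 := (tendsto_nhds_of_tendsto_nhdsWithin hlim).eventually
      (lt_mem_nhds (sub_lt_self d (Nat.one_div_pos_of_nat (α := ℝ) (n := m))))
    obtain ⟨N, hN⟩ := eventually_atTop.1 (h1.and h2)
    refine mem_iUnion.2 ⟨N, mem_iInter₂.2 fun n hn => ?_⟩
    obtain ⟨hne, hTd⟩ := nearInf_nonempty hy hqd hmin n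
    obtain ⟨h3, h4⟩ := hN n hn
    exact ⟨hne, incrFrom_mem_fastPaths (hX.cadlag ω) hTd (by linarith)
      (by simp only [Function.comp_apply] at h3; linarith)⟩
  have hle (m : ℕ) : μ (jumpEvent X α q ε) ≤
      μ.map (incrPath X fun _ => 0) (fastPaths ε (1 / (m + 1))) := by
    refine (measure_mono (hsub m)).trans ?_
    rw [Monotone.measure_iUnion]
    -- The intersection over `n ≥ N` is bounded by its term `n = N`, to which the strong Markov
    -- property at `T N` applies.
    · refine iSup_le fun N => (measure_mono (iInter₂_subset N le_rfl)).trans ?_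
      have hB := measurableSet_fastPaths ε (1 / ((m : ℝ) + 1))
      have h := congrArg (fun ν => ν (fastPaths ε (1 / ((m : ℝ) + 1))))
        (hX.map_incrPath (hT N) (measurableSet_nearInf X α q N))
      simp only [Measure.smul_apply, smul_eq_mul] at h
      rw [Measure.map_apply (hX.measurable_incrPath (hT N)) hB,
        Measure.restrict_apply (hX.measurable_incrPath (hT N) hB), inter_comm] at h
      exact h.le.trans (mul_le_of_le_one_left' prob_le_one)
    · intro N N' hN
      exact iInter₂_mono' fun n hn => ⟨n, hN.trans hn, le_rfl⟩
  exact le_antisymm (ge_of_tendsto' (hX.tendsto_measure_fastPaths hε) hle) zero_le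

/-- Almost surely, at the first contact after any time, the process itself (and not only its left
limit) is at the running infimum. -/
theorem ae_le_of_nextPoint_eq [IsProbabilityMeasure μ] (hX : IsTwoSidedLevy X μ) (α : ℝ) :
    ∀ᵐ ω ∂μ, ∀ t d : ℝ, nextPoint t (contactSet α fun s => X s ω) = d →
      ∀ s ≤ d, X d ω - α * d ≤ X s ω - α * s := by
  -- Rational `q` and jump sizes `1 / (p + 1)` give a single null set that serves all real `t`.
  have hae : ∀ᵐ ω ∂μ, ∀ (q : ℚ) (p : ℕ), ω ∉ jumpEvent X α q (1 / (p + 1)) :=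
    ae_all_iff.2 fun q => ae_all_iff.2 fun p =>
      measure_eq_zero_iff_ae_notMem.1 (hX.measure_jumpEvent α q Nat.one_div_pos_of_nat)
  filter_upwards [hae] with ω hω t d htd s hs
  have hy := (hX.cadlag ω).sub_linear α
  rw [contactSet_eq_lowPoints (hX.cadlag ω)] at htd
  by_contra! hlt
  have hle : t ≤ d := by
    have := coe_le_nextPoint t (lowPoints fun s => X s ω - α * s)
    rw [htd] at this
    exact_mod_cast this
  rcases hle.eq_or_lt with rfl | hlt'
  · exact absurd (le_of_nextPoint_eq_self hy htd hs) (not_le.2 hlt)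
  · have hd := nextPoint_mem (isClosed_lowPoints hy) htd
    obtain ⟨q, hq, hq'⟩ := exists_rat_btwn hlt'
    have hl := (min_le_iff.1 (hd s hs)).resolve_left (not_le.2 hlt)
    rw [(hX.cadlag ω).leftLim_sub_linear] at hl
    obtain ⟨p, hp⟩ := exists_nat_one_div_lt
      (show 0 < X d ω - Function.leftLim (fun s => X s ω) d by linarith)
    refine hω q p ⟨d, hq', hd, disjoint_left.2 fun u hu hu' => ?_, by linarith⟩
    have := nextPoint_le hu (hq.trans_le hu'.1)
    rw [htd, EReal.coe_le_coe_iff] at this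
    exact absurd hu'.2 (not_lt.2 this)

end IsTwoSidedLevy

/-! ### The regeneration property -/

/-- The family `(τ_t(F_j))_j` of all the sets after time `t`. -/
def shiftFamily {n : ℕ} (t : ℝ) (F : Nested (Fin n)) : NestedHalf (Fin n) :=
  ⟨fun j => shift t (F.1 j : Set ℝ), fun _ _ hij =>
    closure_mono (image_mono (inter_subset_inter_left _ (F.2 hij)))⟩

lemma measurable_shiftFamily {n : ℕ} (t : ℝ) :
    Measurable (shiftFamily t : Nested (Fin n) → NestedHalf (Fin n)) := by
  refine Measurable.subtype_mk (measurable_pi_lambda _ fun j => ?_)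
  exact measurable_shift measurable_const ((measurable_pi_apply j).comp measurable_subtype_coe)

lemma measurable_extendPath (γ : ℝ) : Measurable (extendPath γ) := by
  refine measurable_pi_lambda _ fun v => ?_
  unfold extendPath
  split_ifs
  · exact measurable_pi_apply _
  · exact measurable_const

namespace IsTwoSidedLevy

variable {Ω : Type*} [mΩ : MeasurableSpace Ω] {μ : Measure Ω} {X : ℝ → Ω → ℝ}

/-- The path of the increments after a random time, extended to a càdlàg path on the line. -/
def newPath (hX : IsTwoSidedLevy X μ) (γ : ℝ) (T : Ω → ℝ) (ω : Ω) : CadlagPath :=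
  ⟨extendPath γ (incrPath X T ω), isCadlag_extendPath (hX.cadlag ω) γ (T ω)⟩

lemma measurable_newPath (hX : IsTwoSidedLevy X μ) (γ : ℝ) {T : Ω → ℝ} (hT : Measurable T) :
    Measurable (hX.newPath γ T) :=
  ((measurable_extendPath γ).comp (hX.measurable_incrPath hT)).subtype_mk

lemma map_newPath [IsProbabilityMeasure μ] (hX : IsTwoSidedLevy X μ) (γ : ℝ) {G : Set Ω}
    {T : Ω → ℝ} (hT : Measurable T)
    (hG : ∀ q, MeasurableSet[pastIncr X q] (G ∩ {ω | T ω < q})) :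
    (μ.restrict G).map (hX.newPath γ T) = μ G • μ.map (hX.newPath γ fun _ => 0) := by
  ext _ ⟨S, hS, rfl⟩
  have hS' := measurable_extendPath γ hS
  have h := congrArg (fun ν => ν (extendPath γ ⁻¹' S)) (hX.map_incrPath hT hG)
  simp only [Measure.smul_apply, Measure.map_apply (hX.measurable_incrPath hT) hS',
    Measure.map_apply (hX.measurable_incrPath (T := fun _ => 0) measurable_const) hS'] at h
  have hm : MeasurableSet (Subtype.val ⁻¹' S : Set CadlagPath) := measurable_subtype_coe hS
  rw [Measure.smul_apply, Measure.map_apply (hX.measurable_newPath γ hT) hm,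
    Measure.map_apply (hX.measurable_newPath γ measurable_const) hm]
  exact h

/-- The random family of the contact sets. -/
def contactSets (hX : IsTwoSidedLevy X μ) {n : ℕ} {α : Fin n → ℝ} (hα : Monotone α) (ω : Ω) :
    Nested (Fin n) :=
  contactFamily hα ⟨fun t => X t ω, hX.cadlag ω⟩

lemma measurable_contactSets (hX : IsTwoSidedLevy X μ) {n : ℕ} {α : Fin n → ℝ}
    (hα : Monotone α) : Measurable (hX.contactSets hα) :=
  (measurable_contactFamily hα).comp (measurable_pi_lambda _ hX.measurable).subtype_mk

lemma measurable_nextPoint_truncated (hX : IsTwoSidedLevy X μ) (α s q : ℝ) :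
    Measurable[pastIncr X q] fun ω =>
      if nextPoint s (contactSet α fun t => X t ω) < q
        then nextPoint s (contactSet α fun t => X t ω) else ⊤ := by
  refine @measurable_ereal_of_lt _ (pastIncr X q) _ fun r => ?_
  have : {ω | (if nextPoint s (contactSet α fun t => X t ω) < q
      then nextPoint s (contactSet α fun t => X t ω) else ⊤) < (r : EReal)} =
      {ω | nextPoint s (contactSet α fun t => X t ω) < ((min q r : ℝ) : EReal)} := by
    ext ω
    simp only [mem_ofPred_eq, EReal.coe_strictMono.monotone.map_min, lt_min_iff]
    split_ifs with h <;> simp [h]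
  rw [this]
  refine @measurableSet_nextPoint_contactSet_lt _ (pastIncr X q) _ hX.cadlag _ ?_ _ _
  intro a ha b hb
  exact measurable_pastIncr_sub X (ha.le.trans (min_le_left _ _)) (hb.le.trans (min_le_left _ _))

/-- On `{d < q}` the generators of `pastOf k t` can be computed from the next points truncated at
`q`, which increments before `q` determine. -/
lemma measurableSet_pastOf_inter (hX : IsTwoSidedLevy X μ) {n : ℕ} {α : Fin n → ℝ}
    (hα : Monotone α) (k : Fin n) (t q : ℝ) {A : Set (Nested (Fin n))}
    (hA : MeasurableSet[pastOf k t] A) :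
    MeasurableSet[pastIncr X q]
      (hX.contactSets hα ⁻¹' A ∩ {ω | nextPointOf k t (hX.contactSets hα ω) < q}) := by
  let D : Set Ω := {ω | nextPointOf k t (hX.contactSets hα ω) < q}
  have hD : MeasurableSet[pastIncr X q] D :=
    @measurableSet_nextPoint_contactSet_lt _ (pastIncr X q) _ hX.cadlag _
      (fun a ha b hb => measurable_pastIncr_sub X ha.le hb.le) (α k) t
  let e (j : Fin n) (s : ℝ) (ω : Ω) : EReal :=
    if nextPoint s (contactSet (α j) fun t => X t ω) < q
      then nextPoint s (contactSet (α j) fun t => X t ω) else ⊤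
  let mD : MeasurableSpace D := (pastIncr X q).comap Subtype.val
  have he (j : Fin n) (s : ℝ) : Measurable fun ω : D => e j s ω :=
    (hX.measurable_nextPoint_truncated (α j) s q).comp (comap_measurable _)
  have hed (ω : D) : nextPointOf k t (hX.contactSets hα ω) = e k t ω :=
    (if_pos ω.2).symm
  have hM : Measurable[mD, pastOf k t] fun ω : D => hX.contactSets hα ω := by
    refine measurable_iff_pastOf_comap ?_ fun j s => ?_
    · simp_rw [hed]
      exact he k t
    · have : (fun ω : D => nextPoint s (upTo (nextPointOf k t (hX.contactSets hα ω))
          ((hX.contactSets hα ω).1 j) : Set ℝ)) =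
          fun ω : D => if (s : EReal) < e k t ω ∧ e j s ω ≤ e k t ω then e j s ω else ⊤ := by
        ext ω
        rw [nextPoint_upTo, hed]
        -- A next point that is not before `q` lies beyond `d`, so `upTo` discards it just as the
        -- truncation at `q` does.
        by_cases h : nextPoint s (contactSet (α j) fun t => X t (ω : Ω)) < q
        · rw [show e j s ω = _ from if_pos h]
          rfl
        · have h1 : e k t ω < q := hed ω ▸ ω.2
          have h2 : ¬ nextPoint s ((hX.contactSets hα ω).1 j : Set ℝ) ≤ e k t ω :=
            fun h' => h (h'.trans_lt h1)
          rw [if_neg fun h' => h2 h'.2, show e j s ω = _ from if_neg h, ite_self]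
      rw [this]
      exact Measurable.ite ((measurableSet_lt measurable_const (he k t)).inter
        (measurableSet_le (he j s) (he k t))) (he j s) measurable_const
  obtain ⟨B, hB, hB'⟩ := hM hA
  have : hX.contactSets hα ⁻¹' A ∩ D = B ∩ D := by
    ext ω
    refine and_congr_left fun hω => ?_
    exact (Set.ext_iff.1 hB' ⟨ω, hω⟩).symm
  rw [this]
  exact @MeasurableSet.inter _ (pastIncr X q) _ _ hB hD

/-- Almost surely on `G`, the future is a function of the path restarted at `T = d`. Since `G` is in
the past of `T`, the strong Markov property factorizes the integral. -/
lemma setIntegral_future [IsProbabilityMeasure μ] (hX : IsTwoSidedLevy X μ) {n : ℕ}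
    {α : Fin n → ℝ} (hα : Monotone α) {γ : ℝ} (hγ : ∀ i, γ ≤ α i) (k : Fin n) (t : ℝ)
    {f : NestedHalf (Ici k) → ℝ} (hf : Measurable f) {A : Set (Nested (Fin n))}
    (hA : MeasurableSet[pastOf k t] A) :
    ∫ F in A ∩ {F | nextPointOf k t F < ⊤}, f (futureOf k (nextPointOf k t F).toReal F)
        ∂μ.map (hX.contactSets hα) =
      (μ.map (hX.contactSets hα)).real (A ∩ {F | nextPointOf k t F < ⊤}) *
        ∫ G, f (tailOf k G) ∂μ.map
          fun ω => shiftFamily 0 (contactFamily hα (hX.newPath γ (fun _ => 0) ω)) := by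
  have hM := hX.measurable_contactSets hα
  let T (ω : Ω) : ℝ := (nextPointOf k t (hX.contactSets hα ω)).toReal
  have hT : Measurable T := ((measurable_nextPointOf k t).comp hM).ereal_toReal
  have hAD : MeasurableSet (A ∩ {F | nextPointOf k t F < ⊤}) :=
    (pastOf_le k t _ hA).inter (pastOf_le k t _ (measurableSet_nextPointOf_lt_top k t))
  set G : Set Ω := hX.contactSets hα ⁻¹' (A ∩ {F | nextPointOf k t F < ⊤})
  have hT' {ω : Ω} (h : nextPointOf k t (hX.contactSets hα ω) < ⊤) :
      (T ω : EReal) = nextPointOf k t (hX.contactSets hα ω) := coe_toReal_nextPoint h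
  have hG (q : ℝ) : MeasurableSet[pastIncr X q] (G ∩ {ω | T ω < q}) := by
    convert hX.measurableSet_pastOf_inter hα k t q hA using 1
    ext ω
    constructor
    · rintro ⟨⟨h1, h2⟩, h3⟩
      refine ⟨h1, ?_⟩
      rw [mem_ofPred_eq, ← hT' h2]
      exact EReal.coe_lt_coe_iff.2 h3
    · rintro ⟨h1, h2⟩
      have h3 : nextPointOf k t (hX.contactSets hα ω) < ⊤ := lt_of_lt_of_le h2 le_top
      refine ⟨⟨h1, h3⟩, ?_⟩
      rw [mem_ofPred_eq, ← hT' h3] at h2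
      exact EReal.coe_lt_coe_iff.1 h2
  let g (x : CadlagPath) : ℝ := f (tailOf k (shiftFamily 0 (contactFamily hα x)))
  have hh : Measurable fun x : CadlagPath => shiftFamily 0 (contactFamily hα x) :=
    (measurable_shiftFamily 0).comp (measurable_contactFamily hα)
  have hg : Measurable g := hf.comp ((measurable_tailOf k).comp hh)
  have hGm : MeasurableSet G := hM hAD
  have hfut : ∀ᵐ ω ∂μ, ω ∈ G →
      f (futureOf k (nextPointOf k t (hX.contactSets hα ω)).toReal (hX.contactSets hα ω)) =
        g (hX.newPath γ T ω) := by
    filter_upwards [hX.ae_le_of_nextPoint_eq (α k)] with ω hω hωG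
    refine congrArg f (Subtype.ext (funext fun j => ?_))
    exact shift_contactSet (hX.cadlag ω) (hα j.2) (hγ j) (hω t (T ω) (hT' hωG.2).symm)
  have hN0 : Measurable (hX.newPath γ fun _ => 0) := hX.measurable_newPath γ measurable_const
  have hN1 : Measurable fun ω => shiftFamily 0 (contactFamily hα (hX.newPath γ (fun _ => 0) ω)) :=
    hh.comp hN0
  have hf1 : Measurable fun F => f (futureOf k (nextPointOf k t F).toReal F) :=
    hf.comp (measurable_futureOf k t)
  have hf2 : Measurable fun F => f (tailOf k F) := hf.comp (measurable_tailOf k)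
  rw [setIntegral_map hAD hf1.aestronglyMeasurable
      hM.aemeasurable, setIntegral_congr_ae hGm hfut,
    integral_map hN1.aemeasurable hf2.aestronglyMeasurable,
    ← integral_map (hX.measurable_newPath γ hT).aemeasurable hg.aestronglyMeasurable,
    hX.map_newPath γ hT hG, integral_smul_measure, integral_map hN0.aemeasurable
      hg.aestronglyMeasurable, smul_eq_mul, measureReal_def, Measure.map_apply hM hAD]

theorem isRegenerativeEmbeddingLaw [IsProbabilityMeasure μ] (hX : IsTwoSidedLevy X μ) {n : ℕ}
    {α : Fin n → ℝ} (hα : Monotone α) {γ : ℝ} (hγ : ∀ i, γ ≤ α i) :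
    IsRegenerativeEmbeddingLaw (μ.map (hX.contactSets hα)) (μ.map
      fun ω => shiftFamily 0 (contactFamily hα (hX.newPath γ (fun _ => 0) ω))) := by
  intro k t f hf hbdd
  obtain ⟨C, hC⟩ := hbdd
  have hM := hX.measurable_contactSets hα
  have : IsProbabilityMeasure (μ.map (hX.contactSets hα)) :=
    Measure.isProbabilityMeasure_map hM.aemeasurable
  have hD := measurableSet_nextPointOf_lt_top k t
  have hint : Integrable (fun F => f (futureOf k (nextPointOf k t F).toReal F))
      (μ.map (hX.contactSets hα)) :=
    Integrable.of_bound (hf.comp (measurable_futureOf k t)).aestronglyMeasurable C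
      (Eventually.of_forall fun F => hC _)
  -- As `{d < ⊤}` belongs to the conditioning `σ`-field, it is enough to identify the conditional
  -- expectation of the future cut off by its indicator.
  have h1 := condExp_indicator hint hD
  have h2 := ae_eq_condExp_of_forall_setIntegral_eq (pastOf_le k t)
    (f := {F | nextPointOf k t F < ⊤}.indicator
      fun F => f (futureOf k (nextPointOf k t F).toReal F))
    (g := {F | nextPointOf k t F < ⊤}.indicator fun _ => ∫ G, f (tailOf k G) ∂μ.map
      fun ω => shiftFamily 0 (contactFamily hα (hX.newPath γ (fun _ => 0) ω)))
    (μ := μ.map (hX.contactSets hα))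
    (hint.indicator (pastOf_le k t _ hD))
    (fun s _ _ => ((integrable_const _).indicator (pastOf_le k t _ hD)).integrableOn)
    (fun A hA _ => ?_) ?_
  · rw [Filter.EventuallyEq, ae_restrict_iff' (pastOf_le k t _ hD)]
    filter_upwards [h1, h2] with F h1 h2 hF
    rw [← h2, indicator_of_mem (show F ∈ {F | nextPointOf k t F < ⊤} from hF),
      indicator_of_mem (show F ∈ {F | nextPointOf k t F < ⊤} from hF)] at h1
    exact h1.symm
  · rw [setIntegral_indicator (pastOf_le k t _ hD), setIntegral_indicator (pastOf_le k t _ hD),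
      hX.setIntegral_future hα hγ k t hf hA, setIntegral_const, smul_eq_mul]
  · exact (stronglyMeasurable_const.indicator hD).aestronglyMeasurable

end IsTwoSidedLevy

end EmbeddedRegenerative

end

theorem propositionP {Ω : Type*} [MeasurableSpace Ω] (μ : MeasureTheory.Measure Ω)
    [MeasureTheory.IsProbabilityMeasure μ] (X : ℝ → Ω → ℝ)
    (hX : EmbeddedRegenerative.IsTwoSidedLevy X μ)
    (hpos : MeasureTheory.Integrable (fun ω => max (X 1 ω) 0) μ)
    (n : ℕ) (α : Fin n → ℝ) (hα : StrictMono α)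
    (hmean : ∀ i, EmbeddedRegenerative.extMean μ (X 1) < (α i : EReal)) :
    EmbeddedRegenerative.RegenerativelyEmbedded μ
      (fun i ω => EmbeddedRegenerative.contactSet (α i) (fun t => X t ω)) := by
  -- Any common lower bound of the slopes can serve as the slope of the line attached before `0`.
  obtain ⟨γ, hγ⟩ := Finite.bddBelow_range α
  refine ⟨hX.contactSets hα.monotone, hX.measurable_contactSets hα.monotone, fun ω i => rfl, _, ?_,
    hX.isRegenerativeEmbeddingLaw hα.monotone fun i => hγ ⟨i, rfl⟩⟩
  exact MeasureTheory.Measure.isProbabilityMeasure_map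
    (((EmbeddedRegenerative.measurable_shiftFamily 0).comp
      (EmbeddedRegenerative.measurable_contactFamily hα.monotone)).comp
      (hX.measurable_newPath γ measurable_const)).aemeasurable
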